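/- Let $(\Omega,\mathcal F,\mathbb P)$ be a probability space and let $[\underline H,\overline H]\subset(0,1)$ be a compact interval. Let $(H_j)_{j\ge 0}$ be Lipschitz functions $H_j:[0,1]\to[\underline H,\overline H]$ for which there is a constant $C>0$ with $$\sup_{x\in[0,1]}|H_j(x)|+\sup_{0\le x'<x''\le 1}\frac{|H_j(x'')-H_j(x')|}{x''-x'}\le C(1+j)\qquad\text{for all } j\ge 0 .$$ Put $H(t):=\liminf_{j\to\infty}H_j(t)$ and assume that $H(t)<\underline H+\tfrac12$ for all $t\in(0,1)$. Let $\{\varepsilon_{j,k}: j\ge 0,\ 0\le k\le 2^j-1\}$ be independent $\mathcal N(0,1)$ random variables. Let $h=\mathbf 1_{[0,1/2)}-\mathbf 1_{[1/2,1)}$ be the Haar mother wavelet and $h_{j,k}(s)=2^{j/2}h(2^js-k)$, and write $(y)_+^\beta=y^\beta$ for $y\ge 0$ and $(y)_+^\beta=0$ for $y<0$. The Gaussian Haar-based multifractional process is $$X(t)=\sum_{j=0}^{\infty}\sum_{k=0}^{2^j-1}\left(\int_0^1 (t-s)_+^{H_j(k/2^j)-1/2}\,h_{j,k}(s)\,ds\right)\varepsilon_{j,k},\qquad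 t\in[0,1],$$ where for each $t$ the series is understood in $L^2(\mathbb P)$, and $X$ is taken in a version with (almost surely) continuous sample paths. Its pointwise Hölder exponent at $t$ is the random quantity $$\alpha_X(t)=\sup\Big\{\alpha\ge 0:\ \limsup_{h\to 0}\frac{|X(t+h)-X(t)|}{|h|^{\alpha}}=0\Big\}\in[0,+\infty].$$ Then such a continuous version exists; and for every such version $X$ there is a universal event $\Omega_1^*$ (not depending on $t$) with $\mathbb P(\Omega_1^*)=1$ such that, on $\Omega_1^*$, $$\alpha_X(t)\ge H(t)\qquad\text{for all } t\in(0,1).$$ -/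

import Mathlib

open MeasureTheory ProbabilityTheory Filter Topology Set

/-- The power of the positive part: `(y)_+^β = y ^ β` for `y ≥ 0` and `0` for `y < 0`. -/
noncomputable def posPow (y β : ℝ) : ℝ := if 0 ≤ y then y ^ β else 0

/-- The Haar mother wavelet `1_{[0,1/2)} - 1_{[1/2,1)}`. -/
noncomputable def haarMother (s : ℝ) : ℝ :=
  (Ico (0 : ℝ) (1 / 2)).indicator (fun _ => (1 : ℝ)) s
    - (Ico (1 / 2 : ℝ) 1).indicator (fun _ => (1 : ℝ)) s

/-- The dilated and translated Haar wavelet `h_{j,k}(s) = 2^{j/2} h(2^j s - k)`. -/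
noncomputable def haarWavelet (j k : ℕ) (s : ℝ) : ℝ :=
  (2 : ℝ) ^ ((j : ℝ) / 2) * haarMother ((2 : ℝ) ^ j * s - k)

/-- The norm `sup_{[0,1]} |f| + sup_{0 ≤ x' < x'' ≤ 1} |f x'' - f x'| / (x'' - x')` of a Lipschitz
function `f` on `[0,1]`. -/
noncomputable def lipNorm (f : ℝ → ℝ) : ℝ :=
  sSup {r : ℝ | ∃ x ∈ Icc (0 : ℝ) 1, r = |f x|}
    + sSup {r : ℝ | ∃ x ∈ Icc (0 : ℝ) 1, ∃ y ∈ Icc (0 : ℝ) 1, x < y ∧ r = |f y - f x| / (y - x)}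

/-- The deterministic coefficient `∫_0^1 (t - s)_+^{H_j(k/2^j) - 1/2} h_{j,k}(s) ds`. -/
noncomputable def ghbmpCoeff (H : ℕ → ℝ → ℝ) (j k : ℕ) (t : ℝ) : ℝ :=
  ∫ s in (0 : ℝ)..1, posPow (t - s) (H j ((k : ℝ) / (2 : ℝ) ^ j) - 1 / 2) * haarWavelet j k s

/-- The sum of the levels `j < n` of the random Haar series. -/
noncomputable def ghbmpPartialSum {Ω : Type*} (H : ℕ → ℝ → ℝ)
    (ε : (j : ℕ) → Fin (2 ^ j) → Ω → ℝ) (n : ℕ) (t : ℝ) (ω : Ω) : ℝ :=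
  ∑ j ∈ Finset.range n, ∑ k : Fin (2 ^ j), ghbmpCoeff H j k t * ε j k ω

/-- `X`, restricted to the times in `[0,1]`, is the Gaussian Haar-based multifractional process with
coefficients given by `H` and noise `ε`: each `X t` is the `L²`-sum of the random series, and the
version chosen has (almost surely) continuous sample paths. -/
structure IsGHBMP {Ω : Type*} [MeasurableSpace Ω] (μ : Measure Ω) (H : ℕ → ℝ → ℝ)
    (ε : (j : ℕ) → Fin (2 ^ j) → Ω → ℝ) (X : ℝ → Ω → ℝ) : Prop where
  measurable : ∀ t ∈ Icc (0 : ℝ) 1, Measurable (X t)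
  tendsto_L2 : ∀ t ∈ Icc (0 : ℝ) 1,
    Tendsto (fun n : ℕ => eLpNorm (fun ω => X t ω - ghbmpPartialSum H ε n t ω) 2 μ) atTop (𝓝 0)
  continuous_paths : ∀ᵐ ω ∂μ, ContinuousOn (fun t => X t ω) (Icc (0 : ℝ) 1)

/-- The pointwise Hölder exponent at `t ∈ [0,1]` of a function `f` on `[0,1]`,
`sup {α ≥ 0 : limsup_{h → 0} |f (t + h) - f t| / |h|^α = 0}`, where `h ≠ 0` and `t + h ∈ [0,1]`.
The supremum and the upper limit are taken in the extended reals, so that infinite values are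
read correctly. -/
noncomputable def holderExponent (f : ℝ → ℝ) (t : ℝ) : EReal :=
  sSup ((fun α : ℝ => (α : EReal)) '' {α : ℝ | 0 ≤ α ∧
    limsup (fun h : ℝ => ((|f (t + h) - f t| / |h| ^ α : ℝ) : EReal))
      (𝓝[{h : ℝ | h ≠ 0 ∧ t + h ∈ Icc (0 : ℝ) 1}] 0) = 0})

/-- The Hurst function `H(t) = liminf_{j → ∞} H_j(t)`. -/
noncomputable def hurstFunction (H : ℕ → ℝ → ℝ) (t : ℝ) : ℝ :=
  liminf (fun j : ℕ => H j t) atTop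

/-!
The number `c_{j,k}(t)` is, up to the factor `2 ^ (-j H_{j,k})` with `H_{j,k} = H_j(k/2^j)`, the
value at `2 ^ j t - k` of the fractional primitive of the Haar wavelet, which is a second difference
of `x ↦ x_+^γ / γ`, `γ = H_{j,k} + 1/2`. It vanishes on the left, decays like `x ^ (γ - 2)` on the
right, and its increments are Hölder of order `min 1 γ` with a decay like `x ^ (γ - 3)`
(`abs_haarPrimitive_le`, `abs_haarPrimitive_sub_le`).

Fix `t₀` and `α < H(t₀)`. Since the Lipschitz norm of `H_j` is `O(1 + j)`, for large `j` the
parameters `H_{j,k}` exceed some `α' > α` as long as `k/2^j` is within a distance of order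
`1/(1 + j)` of `t₀` (`exists_eventually_hurstLowerBound`). The wavelets within that distance make
the level `j` of size `2 ^ (-j α')` near `t₀`; the others only contribute `2 ^ (-j)` up to a power
of `j` (`exists_levelStd_le`, `exists_sum_abs_ghbmpCoeff_sub_le`). For the increments of a level
at distances below `2 ^ (-j)` it suffices to sum absolute values. For its size this would be too
lossy, because the coefficients are square summable over `k` but need not be summable uniformly:
the level is compared with its standard deviation on a grid of mesh `2 ^ (-5j)`, where Gaussian
tails and the Borel–Cantelli lemma provide the bound almost surely (`ae_exists_noiseBound`).
Outside the null set so obtained everything is deterministic, which makes the event independent of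
the time.

The increment of the level `j` between `t₀` and `t` is then at most `b_j |t - t₀| ^ α` with
`∑ b_j < ∞` (`exists_summable_increment_bound`). The fractional primitive being merely Hölder, each
single level requires `α ≤ H_{j,k} + 1/2`, and this is where `H(t) < Hlo + 1/2` enters. The levels
also converge uniformly on `[0,1]`, which gives a continuous version, and any other version
coincides with it almost surely at all times (`IsGHBMP.ae_eqOn_haarSeries`).
-/

/-! ### The Haar coefficients in closed form -/

theorem posPow_of_nonneg {x : ℝ} (hx : 0 ≤ x) (β : ℝ) : posPow x β = x ^ β := if_pos hx

theorem posPow_of_nonpos {x γ : ℝ} (hx : x ≤ 0) (hγ : 0 < γ) : posPow x γ = 0 := by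
  rcases hx.eq_or_lt with rfl | h
  · simp [posPow, Real.zero_rpow hγ.ne']
  · exact if_neg (not_le.2 h)

theorem posPow_eq_max {γ : ℝ} (hγ : 0 < γ) (x : ℝ) : posPow x γ = max x 0 ^ γ := by
  rcases le_total 0 x with h | h
  · rw [posPow_of_nonneg h, max_eq_left h]
  · rw [posPow_of_nonpos h hγ, max_eq_right h, Real.zero_rpow hγ.ne']

theorem intervalIntegrable_posPow {β : ℝ} (hβ : -1 < β) (a b : ℝ) :
    IntervalIntegrable (fun u => posPow u β) volume a b := by
  have h : (fun u => posPow u β) = (Ici (0 : ℝ)).indicator (fun u => u ^ β) := by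
    ext u
    simp [posPow, indicator_apply]
  rw [h]
  have := intervalIntegral.intervalIntegrable_rpow' hβ (a := a) (b := b)
  exact ⟨this.1.indicator measurableSet_Ici, this.2.indicator measurableSet_Ici⟩

theorem integral_zero_posPow {γ : ℝ} (hγ : 0 < γ) (x : ℝ) :
    ∫ u in (0 : ℝ)..x, posPow u (γ - 1) = posPow x γ / γ := by
  rcases le_total 0 x with h | h
  · have : ∫ u in (0 : ℝ)..x, posPow u (γ - 1) = ∫ u in (0 : ℝ)..x, u ^ (γ - 1) := by
      refine intervalIntegral.integral_congr fun u hu => ?_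
      rw [uIcc_of_le h] at hu
      exact posPow_of_nonneg hu.1 _
    rw [this, integral_rpow (Or.inl (by linarith)), posPow_of_nonneg h]
    simp [Real.zero_rpow hγ.ne']
  · have : ∫ u in x..(0 : ℝ), posPow u (γ - 1) = ∫ u in x..(0 : ℝ), (0 : ℝ) := by
      rw [intervalIntegral.integral_of_le h, intervalIntegral.integral_of_le h,
        integral_Ioc_eq_integral_Ioo, integral_Ioc_eq_integral_Ioo]
      refine setIntegral_congr_fun measurableSet_Ioo fun u hu => ?_
      exact if_neg (not_le.2 hu.2)
    rw [intervalIntegral.integral_symm, this, posPow_of_nonpos h hγ]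
    simp

theorem integral_posPow_sub {γ : ℝ} (hγ : 0 < γ) (t a b : ℝ) :
    ∫ s in a..b, posPow (t - s) (γ - 1) = (posPow (t - a) γ - posPow (t - b) γ) / γ := by
  rw [intervalIntegral.integral_comp_sub_left (fun u => posPow u (γ - 1)),
    ← intervalIntegral.integral_interval_sub_left
      (intervalIntegrable_posPow (by linarith) 0 _) (intervalIntegrable_posPow (by linarith) 0 _),
    integral_zero_posPow hγ, integral_zero_posPow hγ]
  ring

theorem posPow_mul {c : ℝ} (hc : 0 < c) (x γ : ℝ) : posPow (c * x) γ = c ^ γ * posPow x γ := by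
  unfold posPow
  by_cases h : 0 ≤ x
  · rw [if_pos h, if_pos (by positivity), Real.mul_rpow hc.le h]
  · rw [if_neg h, if_neg (by rw [mul_nonneg_iff_of_pos_left hc]; exact h), mul_zero]

/-- The fractional primitive of the Haar mother wavelet: `∫ (x - s)_+^{γ-1} h(s) ds`, written as the
second difference with step `1/2` of `x ↦ x_+^γ / γ`. -/
noncomputable def haarPrimitive (γ x : ℝ) : ℝ :=
  (posPow x γ - 2 * posPow (x - 1 / 2) γ + posPow (x - 1) γ) / γ

theorem haarWavelet_eq (j k : ℕ) (s : ℝ) :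
    haarWavelet j k s = (2 : ℝ) ^ ((j : ℝ) / 2) *
      ((Ico ((k : ℝ) / 2 ^ j) ((k + 1 / 2) / 2 ^ j)).indicator (fun _ => (1 : ℝ)) s
        - (Ico ((k + 1 / 2 : ℝ) / 2 ^ j) ((k + 1) / 2 ^ j)).indicator (fun _ => (1 : ℝ)) s) := by
  have h2 : (0 : ℝ) < 2 ^ j := by positivity
  unfold haarWavelet haarMother
  congr 2
  · refine indicator_eq_indicator ?_ rfl
    simp only [mem_Ico, div_le_iff₀ h2, lt_div_iff₀ h2]
    constructor <;> rintro ⟨h, h'⟩ <;> constructor <;> linarith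
  · refine indicator_eq_indicator ?_ rfl
    simp only [mem_Ico, div_le_iff₀ h2, lt_div_iff₀ h2]
    constructor <;> rintro ⟨h, h'⟩ <;> constructor <;> linarith

theorem integral_mul_indicator_Ico (φ : ℝ → ℝ) {a b : ℝ} (ha : 0 ≤ a) (hab : a ≤ b) (hb : b ≤ 1) :
    ∫ s in (0 : ℝ)..1, φ s * (Ico a b).indicator (fun _ => (1 : ℝ)) s = ∫ s in a..b, φ s := by
  have h : (fun s => φ s * (Ico a b).indicator (fun _ => (1 : ℝ)) s) = (Ico a b).indicator φ := by
    ext s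
    by_cases hs : s ∈ Ico a b <;> simp [hs]
  rw [intervalIntegral.integral_of_le zero_le_one, intervalIntegral.integral_of_le hab, h,
    ← integral_Ico_eq_integral_Ioc, setIntegral_indicator measurableSet_Ico,
    inter_eq_right.2 (Ico_subset_Ico ha hb), integral_Ico_eq_integral_Ioc]

/-- Rescaling reduces every coefficient to the fractional primitive of the mother wavelet. -/
theorem ghbmpCoeff_eq {H : ℕ → ℝ → ℝ} {j k : ℕ} (hk : k < 2 ^ j)
    (hH : -(1 / 2) < H j ((k : ℝ) / 2 ^ j)) (t : ℝ) :
    ghbmpCoeff H j k t = (2 : ℝ) ^ (-(H j ((k : ℝ) / 2 ^ j) * j)) *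
      haarPrimitive (H j ((k : ℝ) / 2 ^ j) + 1 / 2) (2 ^ j * t - k) := by
  have h2 : (0 : ℝ) < 2 ^ j := by positivity
  set Hk := H j ((k : ℝ) / 2 ^ j) with hHk
  have hγ : 0 < Hk + 1 / 2 := by linarith
  have hk' : (k : ℝ) + 1 ≤ 2 ^ j := by exact_mod_cast hk
  have hk0 : (0 : ℝ) ≤ k := k.cast_nonneg
  set φ : ℝ → ℝ := fun s => posPow (t - s) (Hk - 1 / 2) with hφ
  have hint : ∀ a b, IntervalIntegrable φ volume a b := fun a b => by
    have := (intervalIntegrable_posPow (β := Hk - 1 / 2) (by linarith)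
      (t - a) (t - b)).comp_sub_left t
    simpa only [sub_sub_cancel] using this
  have hind : ∀ a b : ℝ, IntervalIntegrable
      (fun s => φ s * (Ico a b).indicator (fun _ => (1 : ℝ)) s) volume 0 1 := fun a b => by
    have h : (fun s => φ s * (Ico a b).indicator (fun _ => (1 : ℝ)) s) = (Ico a b).indicator φ := by
      ext s
      by_cases hs : s ∈ Ico a b <;> simp [hs]
    rw [h]
    exact ⟨(hint 0 1).1.indicator measurableSet_Ico, (hint 0 1).2.indicator measurableSet_Ico⟩
  have hval : ∀ a b, ∫ s in a..b, φ s
      = (posPow (t - a) (Hk + 1 / 2) - posPow (t - b) (Hk + 1 / 2)) / (Hk + 1 / 2) := fun a b => by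
    rw [← integral_posPow_sub hγ]
    simp only [hφ]
    congr 1; ext s; congr 1; ring
  have hcoeff : ghbmpCoeff H j k t = (2 : ℝ) ^ ((j : ℝ) / 2) *
      ((∫ s in (0 : ℝ)..1, φ s * (Ico ((k : ℝ) / 2 ^ j) ((k + 1 / 2) / 2 ^ j)).indicator
          (fun _ => (1 : ℝ)) s)
        - ∫ s in (0 : ℝ)..1, φ s * (Ico ((k + 1 / 2 : ℝ) / 2 ^ j) ((k + 1) / 2 ^ j)).indicator
          (fun _ => (1 : ℝ)) s) := by
    rw [← intervalIntegral.integral_sub (hind _ _) (hind _ _),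
      ← intervalIntegral.integral_const_mul]
    unfold ghbmpCoeff
    congr 1; ext s
    rw [haarWavelet_eq]
    simp only [hφ, ← hHk]
    ring
  have e1 : t - (k : ℝ) / 2 ^ j = (2 ^ j)⁻¹ * (2 ^ j * t - k) := by field_simp
  have e2 : t - ((k : ℝ) + 1 / 2) / 2 ^ j = (2 ^ j)⁻¹ * (2 ^ j * t - k - 1 / 2) := by
    field_simp; ring
  have e3 : t - ((k : ℝ) + 1) / 2 ^ j = (2 ^ j)⁻¹ * (2 ^ j * t - k - 1) := by field_simp; ring
  have hp : (2 : ℝ) ^ (-(Hk * j))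
      = (2 : ℝ) ^ ((j : ℝ) / 2) * ((2 ^ j : ℝ)⁻¹) ^ (Hk + 1 / 2) := by
    rw [← Real.rpow_natCast, ← Real.rpow_neg two_pos.le, ← Real.rpow_mul two_pos.le,
      ← Real.rpow_add two_pos]
    congr 1; ring
  rw [hcoeff, integral_mul_indicator_Ico φ (by positivity) (by gcongr; linarith)
      ((div_le_one h2).2 (by linarith)),
    integral_mul_indicator_Ico φ (by positivity) (by gcongr; linarith)
      ((div_le_one h2).2 (by linarith)), hval, hval, e1, e2, e3,
    posPow_mul (by positivity), posPow_mul (by positivity), posPow_mul (by positivity), hp,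
    haarPrimitive]
  ring

theorem continuous_haarPrimitive {γ : ℝ} (hγ : 0 < γ) : Continuous (haarPrimitive γ) := by
  have h : ∀ c : ℝ, Continuous fun x : ℝ => posPow (x - c) γ := fun c => by
    simp only [posPow_eq_max hγ]
    exact ((continuous_id.sub continuous_const).max continuous_const).rpow_const
      fun _ => Or.inr hγ.le
  unfold haarPrimitive
  have h0 := h 0
  simp only [sub_zero] at h0
  exact ((h0.sub ((h _).const_mul 2)).add (h 1)).div_const _

theorem haarPrimitive_of_nonpos {γ x : ℝ} (hγ : 0 < γ) (hx : x ≤ 0) : haarPrimitive γ x = 0 := by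
  rw [haarPrimitive, posPow_of_nonpos hx hγ,
    posPow_of_nonpos (show x - 1 / 2 ≤ 0 by linarith) hγ,
    posPow_of_nonpos (show x - 1 ≤ 0 by linarith) hγ]
  simp

/-! ### Decay and regularity of the fractional primitive of the Haar wavelet -/

theorem abs_rpow_sub_rpow_le {p x y : ℝ} (hp : p ≤ 1) (hx : 0 < x) (hxy : x ≤ y) :
    |y ^ p - x ^ p| ≤ |p| * x ^ (p - 1) * (y - x) := by
  have := Convex.norm_image_sub_le_of_norm_hasDerivWithin_le (f := fun u : ℝ => u ^ p)
    (f' := fun u => p * u ^ (p - 1)) (s := Icc x y) (C := |p| * x ^ (p - 1)) (x := x) (y := y)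
    (fun u hu => ((Real.hasDerivAt_rpow_const (Or.inl (hx.trans_le hu.1).ne')).hasDerivWithinAt))
    (fun u hu => by
      have hu0 : 0 < u := hx.trans_le hu.1
      rw [Real.norm_eq_abs, abs_mul, abs_of_pos (Real.rpow_pos_of_pos hu0 _)]
      exact mul_le_mul_of_nonneg_left
        (Real.rpow_le_rpow_of_nonpos hx hu.1 (by linarith)) (abs_nonneg _))
    (convex_Icc x y) ⟨le_rfl, hxy⟩ ⟨hxy, le_rfl⟩
  simpa [Real.norm_eq_abs, abs_of_nonneg (sub_nonneg.2 hxy)] using this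

/-- A second difference of `u ↦ u ^ p` is controlled by the second derivative at the left end. -/
theorem abs_secondDiff_rpow_le {p x η : ℝ} (hp : p ≤ 2) (hx : 0 < x) (hη : 0 ≤ η) :
    |(x + 2 * η) ^ p - 2 * (x + η) ^ p + x ^ p| ≤ |p| * |p - 1| * x ^ (p - 2) * η ^ 2 := by
  have := Convex.norm_image_sub_le_of_norm_hasDerivWithin_le
    (f := fun u : ℝ => (u + η) ^ p - u ^ p)
    (f' := fun u => p * (u + η) ^ (p - 1) - p * u ^ (p - 1)) (s := Icc x (x + η))
    (C := |p| * |p - 1| * x ^ (p - 2) * η) (x := x) (y := x + η)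
    (fun u hu => by
      have hu0 : 0 < u := hx.trans_le hu.1
      have h1 : HasDerivAt (fun u : ℝ => (u + η) ^ p) (p * (u + η) ^ (p - 1)) u := by
        simpa using ((hasDerivAt_id' u).add_const η).rpow_const (p := p)
          (Or.inl (by positivity : u + η ≠ 0))
      exact (h1.sub (Real.hasDerivAt_rpow_const (Or.inl hu0.ne'))).hasDerivWithinAt)
    (fun u hu => by
      have hu0 : 0 < u := hx.trans_le hu.1
      have h := abs_rpow_sub_rpow_le (p := p - 1) (by linarith) hu0 (by linarith : u ≤ u + η)
      rw [Real.norm_eq_abs, ← mul_sub, abs_mul, mul_assoc, mul_assoc]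
      refine mul_le_mul_of_nonneg_left (h.trans ?_) (abs_nonneg _)
      have h2 : u ^ (p - 1 - 1) ≤ x ^ (p - 2) := by
        rw [show p - 1 - 1 = p - 2 by ring]
        exact Real.rpow_le_rpow_of_nonpos hx hu.1 (by linarith)
      rw [add_sub_cancel_left, mul_assoc]
      gcongr)
    (convex_Icc _ _) ⟨le_rfl, by linarith⟩ ⟨by linarith, le_rfl⟩
  rw [Real.norm_eq_abs, Real.norm_eq_abs, add_sub_cancel_left, abs_of_nonneg hη] at this
  convert this using 1
  · congr 1
    rw [show x + η + η = x + 2 * η by ring]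
    ring
  · ring

/-- Replacing a point `x ≥ m / 2` by `m` costs only a constant in the negative powers that occur
here. -/
theorem rpow_le_of_half_le {q x m : ℝ} (hq : q ≤ 0) (hq' : -3 ≤ q) (hm : 0 < m) (hx : m / 2 ≤ x) :
    x ^ q ≤ 8 * m ^ q := by
  have h1 : x ^ q ≤ (m / 2) ^ q := Real.rpow_le_rpow_of_nonpos (by positivity) hx hq
  have h2 : (m / 2) ^ q = (2 : ℝ) ^ (-q) * m ^ q := by
    rw [Real.div_rpow hm.le two_pos.le, Real.rpow_neg two_pos.le]; ring
  have h3 : (2 : ℝ) ^ (-q) ≤ 8 := by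
    calc (2 : ℝ) ^ (-q) ≤ 2 ^ (3 : ℝ) := Real.rpow_le_rpow_of_exponent_le one_le_two (by linarith)
      _ = 8 := by norm_num
  rw [h2] at h1
  exact h1.trans (mul_le_mul_of_nonneg_right h3 (Real.rpow_nonneg hm.le _))

/-- The fractional primitive decays like a second derivative of `x ^ γ`. Away from the singularities
`0`, `1/2`, `1`, that is for `m ≥ 4`, this is the bound for second differences; for `m ≤ 4` both
sides are of order one. -/
theorem abs_haarPrimitive_le {γ : ℝ} (h1 : 1 / 2 ≤ γ) (h2 : γ ≤ 3 / 2) (m : ℝ) :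
    |haarPrimitive γ m| ≤ 1024 * max m 1 ^ (γ - 2) := by
  have hγ : 0 < γ := by linarith
  rcases le_total m 4 with h | h
  · have hb : ∀ x : ℝ, x ≤ 4 → 0 ≤ posPow x γ ∧ posPow x γ ≤ 8 := fun x hx => by
      rw [posPow_eq_max hγ]
      refine ⟨by positivity, ?_⟩
      calc max x 0 ^ γ ≤ (4 : ℝ) ^ γ := by gcongr; exact max_le hx (by norm_num)
        _ ≤ 4 ^ (3 / 2 : ℝ) := Real.rpow_le_rpow_of_exponent_le (by norm_num) h2
        _ = 8 := by
          rw [show (4 : ℝ) = 2 ^ (2 : ℝ) by norm_num, ← Real.rpow_mul (by norm_num)]; norm_num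
    have hlow : 1 / 8 ≤ max m 1 ^ (γ - 2) := by
      calc (1 / 8 : ℝ) = 4 ^ (-(3 / 2) : ℝ) := by
            rw [show (4 : ℝ) = 2 ^ (2 : ℝ) by norm_num, ← Real.rpow_mul (by norm_num)]
            rw [show (2 : ℝ) * -(3 / 2) = -(3 : ℝ) by norm_num, Real.rpow_neg (by norm_num)]
            norm_num
        _ ≤ 4 ^ (γ - 2) := Real.rpow_le_rpow_of_exponent_le (by norm_num) (by linarith)
        _ ≤ _ := Real.rpow_le_rpow_of_nonpos (by positivity) (max_le h (by norm_num)) (by linarith)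
    have hnum : |haarPrimitive γ m| ≤ 128 := by
      have := hb m h
      have := hb (m - 1 / 2) (by linarith)
      have := hb (m - 1) (by linarith)
      rw [haarPrimitive, abs_div, abs_of_pos hγ, div_le_iff₀ hγ]
      have : |posPow m γ - 2 * posPow (m - 1 / 2) γ + posPow (m - 1) γ| ≤ 64 := by
        rw [abs_le]; constructor <;> linarith
      linarith
    linarith
  · rw [max_eq_left (by linarith)]
    have hd := abs_secondDiff_rpow_le (p := γ) (x := m - 1) (η := 1 / 2) (by linarith)
      (by linarith) (by norm_num)
    rw [haarPrimitive, posPow_of_nonneg (by linarith), posPow_of_nonneg (by linarith),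
      posPow_of_nonneg (by linarith), abs_div, abs_of_pos hγ, div_le_iff₀ hγ]
    rw [show m - 1 + 2 * (1 / 2) = m by ring, show m - 1 + 1 / 2 = m - 1 / 2 by ring] at hd
    refine hd.trans ?_
    have h3 := rpow_le_of_half_le (q := γ - 2) (x := m - 1) (m := m) (by linarith) (by linarith)
      (by linarith) (by linarith)
    have h4 : |γ - 1| ≤ 1 := by rw [abs_le]; constructor <;> linarith
    have h5 : 0 ≤ m ^ (γ - 2) := by positivity
    have h6 : 0 ≤ (m - 1) ^ (γ - 2) := Real.rpow_nonneg (by linarith) _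
    rw [abs_of_pos hγ]
    calc γ * |γ - 1| * (m - 1) ^ (γ - 2) * (1 / 2) ^ 2
        ≤ γ * 1 * (8 * m ^ (γ - 2)) * (1 / 2) ^ 2 := by gcongr
      _ ≤ 1024 * m ^ (γ - 2) * γ := by nlinarith [mul_nonneg hγ.le h5]

theorem abs_posPow_sub_le {γ a u v : ℝ} (ha1 : a ≤ 1) (haγ : a ≤ γ) (hγ : 0 < γ)
    (h2 : γ ≤ 3 / 2) (hu : u ≤ 5) (hv : v ≤ 5) (huv : |u - v| ≤ 1) :
    |posPow u γ - posPow v γ| ≤ 8 * |u - v| ^ a := by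
  wlog hle : v ≤ u generalizing u v
  · rw [abs_sub_comm, abs_sub_comm u]
    exact this hv hu (by rwa [abs_sub_comm]) (le_of_not_ge hle)
  rw [posPow_eq_max hγ, posPow_eq_max hγ]
  set x := max v 0
  set y := max u 0
  have hx0 : 0 ≤ x := le_max_right _ _
  have hxy : x ≤ y := max_le_max_right _ hle
  have hy5 : y ≤ 5 := max_le hu (by norm_num)
  have hd : y - x ≤ |u - v| := by
    have := abs_max_sub_max_le_abs u v 0
    rwa [abs_of_nonneg (sub_nonneg.2 hxy)] at this
  have hmono : x ^ γ ≤ y ^ γ := by gcongr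
  rcases (abs_nonneg (u - v)).eq_or_lt with h0 | hpos
  · have : x = y := le_antisymm hxy (by linarith)
    rw [this, sub_self, abs_zero]
    positivity
  rw [abs_of_nonneg (sub_nonneg.2 hmono)]
  rcases le_total γ 1 with hγ1 | hγ1
  · have h3 : y ^ γ ≤ x ^ γ + (y - x) ^ γ := by
      have := Real.rpow_add_le_add_rpow hx0 (sub_nonneg.2 hxy) hγ.le hγ1
      rwa [add_sub_cancel] at this
    calc y ^ γ - x ^ γ ≤ (y - x) ^ γ := by linarith
      _ ≤ |u - v| ^ γ := Real.rpow_le_rpow (sub_nonneg.2 hxy) hd hγ.le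
      _ ≤ |u - v| ^ a := Real.rpow_le_rpow_of_exponent_ge hpos huv haγ
      _ ≤ 8 * |u - v| ^ a := by linarith [Real.rpow_nonneg hpos.le a]
  · have hmv := Convex.norm_image_sub_le_of_norm_hasDerivWithin_le (f := fun u : ℝ => u ^ γ)
      (f' := fun u => γ * u ^ (γ - 1)) (s := Icc x y) (C := 8) (x := x) (y := y)
      (fun w hw => (Real.hasDerivAt_rpow_const (Or.inr hγ1)).hasDerivWithinAt)
      (fun w hw => by
        have hw0 : 0 ≤ w := hx0.trans hw.1
        rw [Real.norm_eq_abs, abs_of_nonneg (by positivity)]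
        have : w ^ (γ - 1) ≤ 5 := by
          calc w ^ (γ - 1) ≤ 5 ^ (γ - 1) := by
                apply Real.rpow_le_rpow hw0 (hw.2.trans hy5) (by linarith)
            _ ≤ 5 ^ (1 : ℝ) := Real.rpow_le_rpow_of_exponent_le (by norm_num) (by linarith)
            _ = 5 := by norm_num
        nlinarith)
      (convex_Icc _ _) ⟨le_rfl, hxy⟩ ⟨hxy, le_rfl⟩
    rw [Real.norm_eq_abs, Real.norm_eq_abs, abs_of_nonneg (sub_nonneg.2 hmono),
      abs_of_nonneg (sub_nonneg.2 hxy)] at hmv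
    have h4 : |u - v| ≤ |u - v| ^ a := by
      simpa using Real.rpow_le_rpow_of_exponent_ge hpos huv ha1
    linarith

/-- The increments of the fractional primitive gain one more power of decay. Near the singularities
they are only Hölder of order `min 1 γ`, which limits the exponent `a`. -/
theorem abs_haarPrimitive_sub_le {γ a : ℝ} (ha1 : a ≤ 1) (haγ : a ≤ γ)
    (h1 : 1 / 2 ≤ γ) (h2 : γ ≤ 3 / 2) {m m₀ : ℝ} (hm : |m - m₀| ≤ 1) :
    |haarPrimitive γ m - haarPrimitive γ m₀| ≤ 4096 * |m - m₀| ^ a * max m₀ 1 ^ (γ - 3) := by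
  have hγ : 0 < γ := by linarith
  obtain ⟨hm1, hm2⟩ := abs_le.1 hm
  have hN : 0 ≤ |m - m₀| ^ a := Real.rpow_nonneg (abs_nonneg _) _
  rcases le_total m₀ 4 with h | h
  · have hb : ∀ c : ℝ, 0 ≤ c →
        |posPow (m - c) γ - posPow (m₀ - c) γ| ≤ 8 * |m - m₀| ^ a := fun c hc => by
      have := abs_posPow_sub_le (u := m - c) (v := m₀ - c) ha1 haγ hγ h2 (by linarith)
        (by linarith) (by rwa [sub_sub_sub_cancel_right])
      rwa [sub_sub_sub_cancel_right] at this
    have hlow : 1 / 32 ≤ max m₀ 1 ^ (γ - 3) := by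
      calc (1 / 32 : ℝ) = 4 ^ (-(5 / 2) : ℝ) := by
            rw [show (4 : ℝ) = 2 ^ (2 : ℝ) by norm_num, ← Real.rpow_mul (by norm_num)]
            rw [show (2 : ℝ) * -(5 / 2) = -(5 : ℝ) by norm_num, Real.rpow_neg (by norm_num)]
            norm_num
        _ ≤ 4 ^ (γ - 3) := Real.rpow_le_rpow_of_exponent_le (by norm_num) (by linarith)
        _ ≤ _ := Real.rpow_le_rpow_of_nonpos (by positivity) (max_le h (by norm_num)) (by linarith)
    have hnum : |haarPrimitive γ m - haarPrimitive γ m₀| ≤ 64 * |m - m₀| ^ a := by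
      have e0 := hb 0 le_rfl
      have e1 := hb (1 / 2) (by norm_num)
      have e2 := hb 1 (by norm_num)
      rw [sub_zero, sub_zero] at e0
      rw [abs_le] at e0 e1 e2
      rw [haarPrimitive, haarPrimitive, ← sub_div, abs_div, abs_of_pos hγ, div_le_iff₀ hγ]
      have : |posPow m γ - 2 * posPow (m - 1 / 2) γ + posPow (m - 1) γ -
          (posPow m₀ γ - 2 * posPow (m₀ - 1 / 2) γ + posPow (m₀ - 1) γ)|
          ≤ 32 * |m - m₀| ^ a := by
        rw [abs_le]; constructor <;> linarith
      nlinarith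
    nlinarith
  · rw [max_eq_left (by linarith)]
    -- away from the singularities the derivative is a second difference of `u ↦ u ^ (γ - 1)`
    have hmv := Convex.norm_image_sub_le_of_norm_hasDerivWithin_le
      (f := fun u : ℝ => (u ^ γ - 2 * (u - 1 / 2) ^ γ + (u - 1) ^ γ) / γ)
      (f' := fun u => u ^ (γ - 1) - 2 * (u - 1 / 2) ^ (γ - 1) + (u - 1) ^ (γ - 1))
      (s := Icc (m₀ - 1) (m₀ + 1)) (C := 8 * m₀ ^ (γ - 3)) (x := m₀) (y := m)
      (fun u hu => by
        have d : ∀ c : ℝ, c ≤ 1 → HasDerivAt (fun u : ℝ => (u - c) ^ γ)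
            (γ * (u - c) ^ (γ - 1)) u := fun c hc => by
          have : u - c ≠ 0 := by have := hu.1; intro h0; linarith
          simpa using ((hasDerivAt_id' u).sub_const c).rpow_const (p := γ) (Or.inl this)
        have d0 := d 0 zero_le_one
        simp only [sub_zero] at d0
        have := ((d0.sub ((d (1 / 2) (by norm_num)).const_mul 2)).add (d 1 le_rfl)).div_const γ
        refine (this.congr_deriv ?_).hasDerivWithinAt
        field_simp)
      (fun u hu => by
        obtain ⟨hu1, hu2⟩ := hu
        have hd := abs_secondDiff_rpow_le (p := γ - 1) (x := u - 1) (η := 1 / 2) (by linarith)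
          (by linarith) (by norm_num)
        rw [show u - 1 + 2 * (1 / 2) = u by ring, show u - 1 + 1 / 2 = u - 1 / 2 by ring,
          show γ - 1 - 2 = γ - 3 by ring] at hd
        rw [Real.norm_eq_abs]
        refine hd.trans ?_
        have h3 := rpow_le_of_half_le (q := γ - 3) (x := u - 1) (m := m₀) (by linarith)
          (by linarith) (by linarith) (by linarith)
        have h4 : |γ - 1| ≤ 1 := by rw [abs_le]; constructor <;> linarith
        have h5 : |γ - 1 - 1| ≤ 2 := by rw [abs_le]; constructor <;> linarith
        have h6 : 0 ≤ m₀ ^ (γ - 3) := Real.rpow_nonneg (by linarith) _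
        have h7 : 0 ≤ (u - 1) ^ (γ - 3) := Real.rpow_nonneg (by linarith) _
        calc |γ - 1| * |γ - 1 - 1| * (u - 1) ^ (γ - 3) * (1 / 2) ^ 2
            ≤ 1 * 2 * (8 * m₀ ^ (γ - 3)) * (1 / 2) ^ 2 := by gcongr
          _ ≤ 8 * m₀ ^ (γ - 3) := by linarith)
      (convex_Icc _ _) ⟨by linarith, by linarith⟩ ⟨by linarith, by linarith⟩
    have h4 : |m - m₀| ≤ |m - m₀| ^ a := by
      rcases (abs_nonneg (m - m₀)).eq_or_lt with h0 | hpos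
      · rw [← h0] at hN ⊢; exact hN
      · simpa using Real.rpow_le_rpow_of_exponent_ge hpos hm ha1
    have h6 : 0 ≤ m₀ ^ (γ - 3) := Real.rpow_nonneg (by linarith) _
    simp only [haarPrimitive]
    rw [posPow_of_nonneg (by linarith), posPow_of_nonneg (by linarith),
      posPow_of_nonneg (by linarith), posPow_of_nonneg (by linarith),
      posPow_of_nonneg (by linarith), posPow_of_nonneg (by linarith)]
    rw [Real.norm_eq_abs, Real.norm_eq_abs] at hmv
    refine hmv.trans ?_
    nlinarith [mul_le_mul_of_nonneg_left h4 h6, mul_nonneg hN h6]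

/-! ### Sums of the coefficients over one level -/

/-- The sum over `k` of the wavelet envelopes `max (x - k) 1 ^ (-p)` is bounded uniformly in the
location `x` and the number of terms. -/
theorem exists_sum_envelope_le {p : ℝ} (hp : 1 < p) :
    ∃ S : ℝ, 0 < S ∧ ∀ (N : ℕ) (x : ℝ), 0 ≤ x →
      ∑ k : Fin N, (if ((k : ℕ) : ℝ) < x + 1 then max (x - (k : ℕ)) 1 ^ (-p) else 0) ≤ S := by
  have hs : Summable fun n : ℕ => ((n : ℝ) + 1) ^ (-p) := by
    have := (summable_nat_add_iff 1).2 (Real.summable_nat_rpow.2 (by linarith : -p < -1))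
    simpa using this
  have hnn : ∀ n : ℕ, 0 ≤ ((n : ℝ) + 1) ^ (-p) := fun n => by positivity
  refine ⟨(3 : ℝ) ^ p * ∑' n : ℕ, ((n : ℝ) + 1) ^ (-p) + 1,
    by
      have h : 0 ≤ ∑' n : ℕ, ((n : ℝ) + 1) ^ (-p) := tsum_nonneg hnn
      positivity, fun N x hx => ?_⟩
  rw [Fin.sum_univ_eq_sum_range
    (fun k : ℕ => if (k : ℝ) < x + 1 then max (x - k) 1 ^ (-p) else 0) N, ← Finset.sum_filter]
  -- `L` is the largest index that can occur, and `L - k + 1 ≤ 3 * max (x - k) 1`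
  set L := ⌊x⌋₊ + 1
  have hsub : (Finset.range N).filter (fun k : ℕ => (k : ℝ) < x + 1) ⊆ Finset.range (L + 1) := by
    intro k hk
    have hk2 := (Finset.mem_filter.1 hk).2
    rw [Finset.mem_range]
    have h1 : (k : ℝ) < ⌊x⌋₊ + 1 + 1 := hk2.trans (by linarith [Nat.lt_floor_add_one x])
    have : k < ⌊x⌋₊ + 1 + 1 := by exact_mod_cast h1
    omega
  calc ∑ k ∈ (Finset.range N).filter (fun k : ℕ => (k : ℝ) < x + 1), max (x - k) 1 ^ (-p)
      ≤ ∑ k ∈ Finset.range (L + 1), max (x - k) 1 ^ (-p) :=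
        Finset.sum_le_sum_of_subset_of_nonneg hsub fun k _ _ => by positivity
    _ ≤ ∑ k ∈ Finset.range (L + 1), (3 : ℝ) ^ p * (((L - k : ℕ) : ℝ) + 1) ^ (-p) := by
        refine Finset.sum_le_sum fun k hk => ?_
        have hkL : k ≤ L := Nat.lt_succ_iff.1 (Finset.mem_range.1 hk)
        have h1 : ((L - k : ℕ) : ℝ) + 1 ≤ 3 * max (x - k) 1 := by
          rw [Nat.cast_sub hkL]
          have h2 : (L : ℝ) ≤ x + 1 := by
            have := Nat.floor_le hx
            simp only [L, Nat.cast_add, Nat.cast_one]; linarith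
          linarith [le_max_left (x - k) 1, le_max_right (x - k) 1]
        calc max (x - k) 1 ^ (-p) = (3 : ℝ) ^ p * (3 * max (x - k) 1) ^ (-p) := by
              rw [Real.mul_rpow (by norm_num) (by positivity), ← mul_assoc,
                ← Real.rpow_add (by norm_num)]
              simp
          _ ≤ _ := mul_le_mul_of_nonneg_left
              (Real.rpow_le_rpow_of_nonpos (by positivity) h1 (by linarith)) (by positivity)
    _ = (3 : ℝ) ^ p * ∑ n ∈ Finset.range (L + 1), ((n : ℝ) + 1) ^ (-p) := by
        rw [← Finset.mul_sum]
        congr 1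
        have := Finset.sum_range_reflect (fun n : ℕ => ((n : ℝ) + 1) ^ (-p)) (L + 1)
        rw [← this]
        simp
    _ ≤ (3 : ℝ) ^ p * ∑' n : ℕ, ((n : ℝ) + 1) ^ (-p) :=
        mul_le_mul_of_nonneg_left (hs.sum_le_tsum _ fun n _ => hnn n) (by positivity)
    _ ≤ _ := by linarith

/-- The size of the level `j` of the series near a point around which, up to distance `r`, the
Hurst parameters of the level are at least `α`: the first term comes from the wavelets located
within `r`, the second one bounds the contribution of all the others. -/
noncomputable def levelScale (α r : ℝ) (j : ℕ) : ℝ :=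
  (2 : ℝ) ^ (-(α * j)) + (2 : ℝ) ^ (-(j : ℝ)) / r ^ 3

theorem levelScale_pos {α r : ℝ} (hr : 0 < r) (j : ℕ) : 0 < levelScale α r j := by
  unfold levelScale; positivity

/-- A wavelet with Hurst parameter `h` located at scaled distance `M` is either controlled by the
parameter `α ≤ h`, or so far away that its Hurst parameter does not matter. -/
theorem envelope_le_add {h α q r M : ℝ} {j : ℕ} (hh : 0 ≤ h) (hq : 0 ≤ q) (hq3 : q ≤ 3)
    (hr : 0 < r) (hr1 : r ≤ 1) (hM1 : 1 ≤ M) (hM : M ≤ 2 ^ j) (hor : α ≤ h ∨ r * 2 ^ j ≤ M) :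
    (2 : ℝ) ^ (-(h * j)) * M ^ (h - q)
      ≤ (2 : ℝ) ^ (-(α * j)) * M ^ (α - q) + (2 : ℝ) ^ (-(q * j)) / r ^ 3 := by
  have hM0 : 0 < M := by linarith
  have h2 : (0 : ℝ) < 2 ^ j := by positivity
  have hw : ∀ b : ℝ, (2 : ℝ) ^ (-(b * j)) * M ^ (b - q) = (M / 2 ^ j) ^ b * M ^ (-q) := fun b => by
    rw [Real.div_rpow hM0.le h2.le, ← Real.rpow_natCast, ← Real.rpow_mul two_pos.le,
      sub_eq_add_neg, Real.rpow_add hM0, mul_comm (b : ℝ) j, Real.rpow_neg two_pos.le]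
    ring
  have hw1 : M / 2 ^ j ≤ 1 := (div_le_one h2).2 hM
  have hw0 : 0 < M / 2 ^ j := by positivity
  rw [hw, hw]
  rcases hor with ho | ho
  · have : (M / 2 ^ j) ^ h ≤ (M / 2 ^ j) ^ α := Real.rpow_le_rpow_of_exponent_ge hw0 hw1 ho
    have h3 : 0 ≤ (2 : ℝ) ^ (-(q * j)) / r ^ 3 := by positivity
    have h4 : 0 ≤ M ^ (-q) := by positivity
    nlinarith
  · have h1 : (M / 2 ^ j) ^ h ≤ 1 := Real.rpow_le_one hw0.le hw1 hh
    have h3 : M ^ (-q) ≤ (2 : ℝ) ^ (-(q * j)) / r ^ 3 := by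
      calc M ^ (-q) ≤ (r * 2 ^ j) ^ (-q) :=
            Real.rpow_le_rpow_of_nonpos (by positivity) ho (by linarith)
        _ = (2 : ℝ) ^ (-(q * j)) * r ^ (-q) := by
            rw [Real.mul_rpow hr.le h2.le, ← Real.rpow_natCast, ← Real.rpow_mul two_pos.le]
            rw [mul_comm]; congr 2; ring
        _ ≤ (2 : ℝ) ^ (-(q * j)) * r ^ (-(3 : ℝ)) := mul_le_mul_of_nonneg_left
            (Real.rpow_le_rpow_of_exponent_ge hr hr1 (by linarith)) (by positivity)
        _ = _ := by
            rw [Real.rpow_neg hr.le, div_eq_mul_inv]; norm_cast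
    have h4 : 0 ≤ M ^ (-q) := by positivity
    have h5 : 0 ≤ (M / 2 ^ j) ^ α * M ^ (-q) := by positivity
    nlinarith

/-- Around `t`, up to distance `r`, the Hurst parameters of the level `j` are at least `α`. -/
def HurstLowerBound (H : ℕ → ℝ → ℝ) (j : ℕ) (t r α : ℝ) : Prop :=
  ∀ k : Fin (2 ^ j), |t - (k : ℕ) / 2 ^ j| ≤ r → α ≤ H j ((k : ℕ) / 2 ^ j)

theorem dyadic_mem_Icc {j : ℕ} (k : Fin (2 ^ j)) : ((k : ℕ) : ℝ) / 2 ^ j ∈ Icc (0 : ℝ) 1 := by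
  have : ((k : ℕ) : ℝ) ≤ 2 ^ j := by exact_mod_cast k.2.le
  exact ⟨by positivity, (div_le_one (by positivity)).2 this⟩

/-- The envelope of a wavelet in terms of a local lower bound of the Hurst parameters. The condition
on `k` leaves room for one wavelet located to the right of `t`, which occurs in increments. -/
theorem hurst_envelope_le {H : ℕ → ℝ → ℝ} {j : ℕ} {t r α q : ℝ} (ht1 : t ≤ 1)
    (hr : 0 < r) (hr1 : r ≤ 1) (hq : 0 ≤ q) (hq3 : q ≤ 3) (hα : HurstLowerBound H j t r α)
    (k : Fin (2 ^ j)) (hH0 : 0 ≤ H j ((k : ℕ) / 2 ^ j)) (hk : ((k : ℕ) : ℝ) < 2 ^ j * t + 1) :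
    (2 : ℝ) ^ (-(H j ((k : ℕ) / 2 ^ j) * j)) *
        max (2 ^ j * t - (k : ℕ)) 1 ^ (H j ((k : ℕ) / 2 ^ j) - q)
      ≤ (2 : ℝ) ^ (-(α * j)) * max (2 ^ j * t - (k : ℕ)) 1 ^ (α - q)
        + (2 : ℝ) ^ (-(q * j)) / r ^ 3 := by
  have h2 : (1 : ℝ) ≤ 2 ^ j := one_le_pow₀ one_le_two
  have hk0 : (0 : ℝ) ≤ (k : ℕ) := Nat.cast_nonneg _
  refine envelope_le_add hH0 hq hq3 hr hr1 (le_max_right _ _)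
    (max_le (by nlinarith) h2) ?_
  by_cases hd : |t - (k : ℕ) / 2 ^ j| ≤ r
  · exact Or.inl (hα k hd)
  · right
    have he : t - (k : ℕ) / 2 ^ j = (2 ^ j * t - (k : ℕ)) / 2 ^ j := by field_simp
    rw [he, not_le, abs_div, abs_of_pos (by positivity : (0 : ℝ) < 2 ^ j),
      lt_div_iff₀ (by positivity)] at hd
    rcases abs_cases (2 ^ j * t - ((k : ℕ) : ℝ)) with ⟨h, _⟩ | ⟨h, _⟩
    · exact (hd.le.trans_eq h).trans (le_max_left _ _)
    · exact le_trans (by linarith) (le_max_right _ _)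

/-- The standard deviation of the level `j` of the random series at time `t`. -/
noncomputable def levelStd (H : ℕ → ℝ → ℝ) (j : ℕ) (t : ℝ) : ℝ :=
  √(∑ k : Fin (2 ^ j), ghbmpCoeff H j k t ^ 2)

/-- The standard deviation of a level is at most its scale: `2 (α - 3/2) < -1`, so the squares of
the envelopes of the wavelets are summable. -/
theorem exists_levelStd_le {Hlo Hhi : ℝ} (hlo : 0 < Hlo) (hhi : Hhi < 1) {H : ℕ → ℝ → ℝ}
    (hrange : ∀ j : ℕ, ∀ x ∈ Icc (0 : ℝ) 1, H j x ∈ Icc Hlo Hhi) :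
    ∃ C : ℝ, 0 < C ∧ ∀ (j : ℕ) (t r α : ℝ), t ∈ Icc (0 : ℝ) 1 → 0 < r → r ≤ 1 → α ≤ Hhi →
      HurstLowerBound H j t r α → levelStd H j t ≤ C * levelScale α r j := by
  obtain ⟨S, hS, hsum⟩ := exists_sum_envelope_le (p := 3 - 2 * Hhi) (by linarith)
  refine ⟨2048 * (√S + 1), by positivity, fun j t r α ht hr hr1 hα hb => ?_⟩
  have hC : 0 ≤ 2048 * (√S + 1) * levelScale α r j := by
    have := (levelScale_pos (α := α) hr j).le
    positivity
  rw [levelStd, Real.sqrt_le_left hC]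
  set A := (2 : ℝ) ^ (-(α * j))
  set B := (2 : ℝ) ^ (-(j : ℝ)) / r ^ 3
  have hA : 0 ≤ A := by positivity
  have hB : 0 ≤ B := by positivity
  have hBj : ((2 : ℝ) ^ (-(3 / 2 * (j : ℝ))) / r ^ 3) ^ 2 * 2 ^ j = B ^ 2 := by
    have : ((2 : ℝ) ^ (-(3 / 2 * (j : ℝ)))) ^ 2 * 2 ^ j = ((2 : ℝ) ^ (-(j : ℝ))) ^ 2 := by
      rw [← Real.rpow_natCast 2 j, ← Real.rpow_natCast _ 2, ← Real.rpow_natCast _ 2,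
        ← Real.rpow_mul two_pos.le, ← Real.rpow_mul two_pos.le, ← Real.rpow_add two_pos]
      congr 1; push_cast; ring
    simp only [B, div_pow]
    rw [← this]; ring
  have hterm : ∀ k : Fin (2 ^ j), ghbmpCoeff H j k t ^ 2 ≤ 1024 ^ 2 * 2 * (A ^ 2 *
      (if ((k : ℕ) : ℝ) < 2 ^ j * t + 1 then max (2 ^ j * t - (k : ℕ)) 1 ^ (-(3 - 2 * Hhi)) else 0)
      + ((2 : ℝ) ^ (-(3 / 2 * (j : ℝ))) / r ^ 3) ^ 2) := fun k => by
    have hHk := hrange j _ (dyadic_mem_Icc k)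
    rw [ghbmpCoeff_eq k.2 (by linarith [hHk.1])]
    set M := max (2 ^ j * t - ((k : ℕ) : ℝ)) 1 with hM
    have hM1 : 1 ≤ M := le_max_right _ _
    split_ifs with hk
    · have h1 := abs_haarPrimitive_le (γ := H j ((k : ℕ) / 2 ^ j) + 1 / 2)
        (by linarith [hHk.1]) (by linarith [hHk.2]) (2 ^ j * t - ((k : ℕ) : ℝ))
      have h2 := hurst_envelope_le (q := 3 / 2) ht.2 hr hr1 (by norm_num) (by norm_num) hb k
        (by linarith [hHk.1]) hk
      rw [show H j ((k : ℕ) / 2 ^ j) + 1 / 2 - 2 = H j ((k : ℕ) / 2 ^ j) - 3 / 2 by ring, ← hM]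
        at h1
      rw [← hM] at h2
      have h3 : |(2 : ℝ) ^ (-(H j ((k : ℕ) / 2 ^ j) * j)) *
          haarPrimitive (H j ((k : ℕ) / 2 ^ j) + 1 / 2) (2 ^ j * t - (k : ℕ))|
          ≤ 1024 * (A * M ^ (α - 3 / 2) + (2 : ℝ) ^ (-(3 / 2 * (j : ℝ))) / r ^ 3) := by
        rw [abs_mul, abs_of_pos (by positivity : (0 : ℝ) < 2 ^ (-(H j ((k : ℕ) / 2 ^ j) * j)))]
        calc _ ≤ (2 : ℝ) ^ (-(H j ((k : ℕ) / 2 ^ j) * j)) *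
              (1024 * M ^ (H j ((k : ℕ) / 2 ^ j) - 3 / 2)) := by gcongr
          _ ≤ _ := by linarith
      have h4 : (M ^ (α - 3 / 2)) ^ 2 ≤ M ^ (-(3 - 2 * Hhi)) := by
        rw [← Real.rpow_natCast, ← Real.rpow_mul (by linarith)]
        exact Real.rpow_le_rpow_of_exponent_le hM1 (by push_cast; linarith)
      rw [← sq_abs]
      calc _ ≤ (1024 * (A * M ^ (α - 3 / 2) + (2 : ℝ) ^ (-(3 / 2 * (j : ℝ))) / r ^ 3)) ^ 2 := by
            gcongr
        _ ≤ 1024 ^ 2 * 2 * (A ^ 2 * (M ^ (α - 3 / 2)) ^ 2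
              + ((2 : ℝ) ^ (-(3 / 2 * (j : ℝ))) / r ^ 3) ^ 2) := by
            nlinarith [sq_nonneg (A * M ^ (α - 3 / 2) - (2 : ℝ) ^ (-(3 / 2 * (j : ℝ))) / r ^ 3)]
        _ ≤ _ := by gcongr
    · rw [haarPrimitive_of_nonpos (by linarith [hHk.1]) (by linarith)]
      simp only [mul_zero, zero_add, ne_eq, OfNat.ofNat_ne_zero, not_false_eq_true, zero_pow]
      positivity
  have hx : 0 ≤ 2 ^ j * t := mul_nonneg (by positivity) ht.1
  calc ∑ k : Fin (2 ^ j), ghbmpCoeff H j k t ^ 2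
      ≤ ∑ k : Fin (2 ^ j), 1024 ^ 2 * 2 * (A ^ 2 *
        (if ((k : ℕ) : ℝ) < 2 ^ j * t + 1 then
          max (2 ^ j * t - (k : ℕ)) 1 ^ (-(3 - 2 * Hhi)) else 0)
        + ((2 : ℝ) ^ (-(3 / 2 * (j : ℝ))) / r ^ 3) ^ 2) := Finset.sum_le_sum fun k _ => hterm k
    _ = 1024 ^ 2 * 2 * (A ^ 2 * (∑ k : Fin (2 ^ j), if ((k : ℕ) : ℝ) < 2 ^ j * t + 1 then
          max (2 ^ j * t - (k : ℕ)) 1 ^ (-(3 - 2 * Hhi)) else 0) + B ^ 2) := by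
        rw [← Finset.mul_sum, Finset.sum_add_distrib, ← Finset.mul_sum, Finset.sum_const, ← hBj]
        simp only [Finset.card_univ, Fintype.card_fin, nsmul_eq_mul, Nat.cast_pow, Nat.cast_ofNat]
        ring
    _ ≤ 1024 ^ 2 * 2 * (A ^ 2 * S + B ^ 2) := by gcongr; exact hsum _ _ hx
    _ ≤ (2048 * (√S + 1) * levelScale α r j) ^ 2 := by
        have hs2 : S = √S ^ 2 := (Real.sq_sqrt hS.le).symm
        have hs0 := Real.sqrt_nonneg S
        rw [show levelScale α r j = A + B from rfl]
        have e1 : A ^ 2 * S ≤ ((√S + 1) * (A + B)) ^ 2 := by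
          rw [show A ^ 2 * S = (A * √S) ^ 2 by rw [mul_pow, ← hs2]]
          exact pow_le_pow_left₀ (by positivity) (by nlinarith [mul_nonneg hs0 hB]) 2
        have e2 : B ^ 2 ≤ ((√S + 1) * (A + B)) ^ 2 := by
          gcongr
          nlinarith [mul_nonneg hs0 hB, mul_nonneg hs0 hA]
        nlinarith

/-- At distances below `2^(-j)` the increments of the coefficients of a level are absolutely
summable, because their envelopes have the exponent `α - 5/2 < -3/2`. -/
theorem exists_sum_abs_ghbmpCoeff_sub_le {Hlo Hhi : ℝ} (hlo : 0 < Hlo) (hhi : Hhi < 1)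
    {H : ℕ → ℝ → ℝ} (hrange : ∀ j : ℕ, ∀ x ∈ Icc (0 : ℝ) 1, H j x ∈ Icc Hlo Hhi) :
    ∃ C : ℝ, 0 < C ∧ ∀ (j : ℕ) (t t₀ r α a : ℝ), t₀ ∈ Icc (0 : ℝ) 1 → 2 ^ j * |t - t₀| ≤ 1 →
      0 < r → r ≤ 1 → α ≤ Hhi → a ≤ 1 → a ≤ Hlo + 1 / 2 → HurstLowerBound H j t₀ r α →
      ∑ k : Fin (2 ^ j), |ghbmpCoeff H j k t - ghbmpCoeff H j k t₀|
        ≤ C * (2 ^ j * |t - t₀|) ^ a * levelScale α r j := by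
  obtain ⟨S, hS, hsum⟩ := exists_sum_envelope_le (p := 3 / 2) (by norm_num)
  refine ⟨4096 * (S + 1), by positivity, fun j t t₀ r α a ht htt hr hr1 hα ha1 ha hb => ?_⟩
  set A := (2 : ℝ) ^ (-(α * j))
  set B := (2 : ℝ) ^ (-(j : ℝ)) / r ^ 3
  set D := (2 ^ j * |t - t₀|) ^ a
  have hA : 0 ≤ A := by positivity
  have hB : 0 ≤ B := by positivity
  have hD : 0 ≤ D := by positivity
  have hBj : (2 : ℝ) ^ (-(5 / 2 * (j : ℝ))) / r ^ 3 * 2 ^ j ≤ B := by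
    have : (2 : ℝ) ^ (-(5 / 2 * (j : ℝ))) * 2 ^ j ≤ (2 : ℝ) ^ (-(j : ℝ)) := by
      rw [← Real.rpow_natCast 2 j, ← Real.rpow_add two_pos]
      refine Real.rpow_le_rpow_of_exponent_le one_le_two ?_
      have : (0 : ℝ) ≤ j := j.cast_nonneg
      linarith
    rw [div_mul_eq_mul_div]
    exact div_le_div_of_nonneg_right this (by positivity)
  have hdiff : ∀ k : ℕ, (2 ^ j * t - (k : ℝ)) - (2 ^ j * t₀ - k) = 2 ^ j * (t - t₀) :=
    fun k => by ring
  have habs : |2 ^ j * (t - t₀)| = 2 ^ j * |t - t₀| := by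
    rw [abs_mul, abs_of_pos (by positivity)]
  have hterm : ∀ k : Fin (2 ^ j), |ghbmpCoeff H j k t - ghbmpCoeff H j k t₀| ≤ 4096 * D * (A *
      (if ((k : ℕ) : ℝ) < 2 ^ j * t₀ + 1 then max (2 ^ j * t₀ - (k : ℕ)) 1 ^ (-(3 / 2 : ℝ)) else 0)
      + (2 : ℝ) ^ (-(5 / 2 * (j : ℝ))) / r ^ 3) := fun k => by
    have hHk := hrange j _ (dyadic_mem_Icc k)
    rw [ghbmpCoeff_eq k.2 (by linarith [hHk.1]), ghbmpCoeff_eq k.2 (by linarith [hHk.1])]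
    set M := max (2 ^ j * t₀ - ((k : ℕ) : ℝ)) 1 with hM
    have hM1 : 1 ≤ M := le_max_right _ _
    split_ifs with hk
    · have h1 := abs_haarPrimitive_sub_le (γ := H j ((k : ℕ) / 2 ^ j) + 1 / 2) (a := a)
        (m := 2 ^ j * t - ((k : ℕ) : ℝ)) (m₀ := 2 ^ j * t₀ - ((k : ℕ) : ℝ)) ha1
        (by linarith [hHk.1]) (by linarith [hHk.1]) (by linarith [hHk.2])
        (by rw [hdiff, habs]; exact htt)
      have h2 := hurst_envelope_le (q := 5 / 2) ht.2 hr hr1 (by norm_num) (by norm_num) hb k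
        (by linarith [hHk.1]) hk
      rw [hdiff, habs, show H j ((k : ℕ) / 2 ^ j) + 1 / 2 - 3 = H j ((k : ℕ) / 2 ^ j) - 5 / 2 by
        ring, ← hM] at h1
      rw [← hM] at h2
      have h4 : M ^ (α - 5 / 2) ≤ M ^ (-(3 / 2 : ℝ)) :=
        Real.rpow_le_rpow_of_exponent_le hM1 (by linarith)
      rw [← mul_sub, abs_mul,
        abs_of_pos (by positivity : (0 : ℝ) < 2 ^ (-(H j ((k : ℕ) / 2 ^ j) * j)))]
      calc _ ≤ (2 : ℝ) ^ (-(H j ((k : ℕ) / 2 ^ j) * j)) *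
              (4096 * D * M ^ (H j ((k : ℕ) / 2 ^ j) - 5 / 2)) := by gcongr
        _ = 4096 * D * ((2 : ℝ) ^ (-(H j ((k : ℕ) / 2 ^ j) * j)) *
              M ^ (H j ((k : ℕ) / 2 ^ j) - 5 / 2)) := by ring
        _ ≤ 4096 * D * (A * M ^ (α - 5 / 2) + (2 : ℝ) ^ (-(5 / 2 * (j : ℝ))) / r ^ 3) := by
            gcongr
        _ ≤ _ := by gcongr
    · -- both times lie to the left of the support of the fractional primitive
      have h5 : 2 ^ j * t - ((k : ℕ) : ℝ) ≤ 0 := by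
        have := le_abs_self (2 ^ j * (t - t₀))
        rw [habs] at this
        linarith
      rw [haarPrimitive_of_nonpos (by linarith [hHk.1]) h5,
        haarPrimitive_of_nonpos (by linarith [hHk.1]) (by linarith)]
      simp only [mul_zero, zero_add, sub_zero, abs_zero]
      positivity
  have hx : 0 ≤ 2 ^ j * t₀ := mul_nonneg (by positivity) ht.1
  calc ∑ k : Fin (2 ^ j), |ghbmpCoeff H j k t - ghbmpCoeff H j k t₀|
      ≤ ∑ k : Fin (2 ^ j), 4096 * D * (A *
        (if ((k : ℕ) : ℝ) < 2 ^ j * t₀ + 1 then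
          max (2 ^ j * t₀ - (k : ℕ)) 1 ^ (-(3 / 2 : ℝ)) else 0)
        + (2 : ℝ) ^ (-(5 / 2 * (j : ℝ))) / r ^ 3) := Finset.sum_le_sum fun k _ => hterm k
    _ = 4096 * D * (A * (∑ k : Fin (2 ^ j), if ((k : ℕ) : ℝ) < 2 ^ j * t₀ + 1 then
          max (2 ^ j * t₀ - (k : ℕ)) 1 ^ (-(3 / 2 : ℝ)) else 0)
          + (2 : ℝ) ^ (-(5 / 2 * (j : ℝ))) / r ^ 3 * 2 ^ j) := by
        rw [← Finset.mul_sum, Finset.sum_add_distrib, ← Finset.mul_sum, Finset.sum_const]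
        simp only [Finset.card_univ, Fintype.card_fin, nsmul_eq_mul, Nat.cast_pow, Nat.cast_ofNat]
        ring
    _ ≤ 4096 * D * (A * S + B) := by gcongr; exact hsum _ _ hx
    _ ≤ 4096 * D * ((S + 1) * (A + B)) := by
        have : A * S + B ≤ (S + 1) * (A + B) := by nlinarith [mul_nonneg hS.le hB]
        gcongr
    _ = _ := by rw [show levelScale α r j = A + B from rfl]; ring

/-! ### The random series for a fixed realisation of the noise -/

/-- The level `j` of the Haar series, for a given realisation `e` of the noise of that level. -/
noncomputable def levelSum (H : ℕ → ℝ → ℝ) (j : ℕ) (e : Fin (2 ^ j) → ℝ) (t : ℝ) : ℝ :=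
  ∑ k : Fin (2 ^ j), ghbmpCoeff H j k t * e k

/-- The growth that almost every realisation `e` of the noise satisfies for some constant `K`. The
second bound expresses the cancellations in the level `j`, tested on a grid of mesh `2^(-5j)`. -/
structure NoiseBound (H : ℕ → ℝ → ℝ) (e : (j : ℕ) → Fin (2 ^ j) → ℝ) (K : ℝ) : Prop where
  nonneg : 0 ≤ K
  noise : ∀ (j : ℕ) (k : Fin (2 ^ j)), |e j k| ≤ K * (1 + j)
  grid : ∀ (j n : ℕ), n ≤ 2 ^ (5 * j) →
    |levelSum H j (e j) ((n : ℝ) / 2 ^ (5 * j))|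
      ≤ K * (1 + j) * levelStd H j ((n : ℝ) / 2 ^ (5 * j))

theorem abs_levelSum_sub_le {H : ℕ → ℝ → ℝ} {e : (j : ℕ) → Fin (2 ^ j) → ℝ} {K : ℝ}
    (he : NoiseBound H e K) (j : ℕ) (t t₀ : ℝ) :
    |levelSum H j (e j) t - levelSum H j (e j) t₀| ≤
      K * (1 + j) * ∑ k : Fin (2 ^ j), |ghbmpCoeff H j k t - ghbmpCoeff H j k t₀| := by
  rw [levelSum, levelSum, ← Finset.sum_sub_distrib, Finset.mul_sum]
  refine (Finset.abs_sum_le_sum_abs _ _).trans (Finset.sum_le_sum fun k _ => ?_)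
  rw [← sub_mul, abs_mul, mul_comm]
  exact mul_le_mul_of_nonneg_right (he.noise j k) (abs_nonneg _)

theorem HurstLowerBound.of_range {Hlo Hhi : ℝ} {H : ℕ → ℝ → ℝ}
    (hrange : ∀ j : ℕ, ∀ x ∈ Icc (0 : ℝ) 1, H j x ∈ Icc Hlo Hhi) (j : ℕ) (t r : ℝ) :
    HurstLowerBound H j t r Hlo := fun k _ => (hrange j _ (dyadic_mem_Icc k)).1

theorem HurstLowerBound.of_near {H : ℕ → ℝ → ℝ} {j : ℕ} {t t' r r' α : ℝ}
    (h : HurstLowerBound H j t r α) (htr : |t - t'| + r' ≤ r) : HurstLowerBound H j t' r' α :=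
  fun k hk => h k (by linarith [abs_sub_le t t' ((k : ℕ) / 2 ^ j)])

/-- Away from the grid the level is controlled by its value at the neighbouring grid point, the mesh
being so small that the crude Hölder bound suffices. -/
theorem exists_abs_levelSum_le {Hlo Hhi : ℝ} (hlo : 0 < Hlo) (hhi : Hhi < 1) {H : ℕ → ℝ → ℝ}
    (hrange : ∀ j : ℕ, ∀ x ∈ Icc (0 : ℝ) 1, H j x ∈ Icc Hlo Hhi) :
    ∃ C : ℝ, 0 < C ∧ ∀ (e : (j : ℕ) → Fin (2 ^ j) → ℝ) (K : ℝ), NoiseBound H e K →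
      ∀ (j : ℕ) (t r α : ℝ), t ∈ Icc (0 : ℝ) 1 → 0 < r → r ≤ 1 → α ≤ Hhi →
      1 / 2 ^ (5 * j) ≤ r → HurstLowerBound H j t (2 * r) α →
      |levelSum H j (e j) t| ≤ C * (K * (1 + j)) * levelScale α r j := by
  have hlohi : Hlo ≤ Hhi := by
    have := hrange 0 0 ⟨le_rfl, zero_le_one⟩
    exact this.1.trans this.2
  obtain ⟨C₁, hC₁, h₁⟩ := exists_levelStd_le hlo hhi hrange
  obtain ⟨C₂, hC₂, h₂⟩ := exists_sum_abs_ghbmpCoeff_sub_le hlo hhi hrange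
  refine ⟨C₁ + 2 * C₂, by positivity, fun e K he j t r α ht hr hr1 hα hj hb => ?_⟩
  have hN : (0 : ℝ) < 2 ^ (5 * j) := by positivity
  -- `τ` is the grid point left of `t`; the Hölder order `1/2` and `2 ^ j * (t - τ) ≤ 2 ^ (-4j)`
  -- make the error `O(2 ^ (-2j))`, which is below every scale
  set n := ⌊t * 2 ^ (5 * j)⌋₊
  set τ : ℝ := (n : ℝ) / 2 ^ (5 * j) with hτ
  have hn1 : (n : ℝ) ≤ t * 2 ^ (5 * j) := Nat.floor_le (mul_nonneg ht.1 hN.le)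
  have hn2 : t * 2 ^ (5 * j) < n + 1 := Nat.lt_floor_add_one _
  have hτt : τ ≤ t := (div_le_iff₀ hN).2 hn1
  have hτt' : t - τ ≤ 1 / 2 ^ (5 * j) := by
    rw [hτ, le_div_iff₀ hN, sub_mul, div_mul_cancel₀ _ hN.ne']; linarith
  have habs : |t - τ| = t - τ := abs_of_nonneg (by linarith)
  have hnN : n ≤ 2 ^ (5 * j) := by
    have : (n : ℝ) ≤ 2 ^ (5 * j) := by nlinarith [ht.2]
    exact_mod_cast this
  have hτI : τ ∈ Icc (0 : ℝ) 1 := ⟨by positivity, hτt.trans ht.2⟩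
  have h2j : (2 : ℝ) ^ j * (1 / 2 ^ (5 * j)) = (2 : ℝ) ^ (-(4 * j : ℝ)) := by
    rw [← Real.rpow_natCast, ← Real.rpow_natCast, one_div, ← Real.rpow_neg two_pos.le,
      ← Real.rpow_add two_pos]
    congr 1; push_cast; ring
  have hsmall : 2 ^ j * |t - τ| ≤ (2 : ℝ) ^ (-(4 * j : ℝ)) := by
    rw [habs, ← h2j]; gcongr
  have hle1 : (2 : ℝ) ^ (-(4 * j : ℝ)) ≤ 1 :=
    Real.rpow_le_one_of_one_le_of_nonpos one_le_two (by simp)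
  have hgrid : |levelSum H j (e j) τ| ≤ C₁ * (K * (1 + j)) * levelScale α r j := by
    have := h₁ j τ r α hτI hr hr1 hα (hb.of_near (by rw [habs]; linarith))
    refine (he.grid j n hnN).trans ?_
    have hK : 0 ≤ K * (1 + (j : ℝ)) := mul_nonneg he.nonneg (by positivity)
    nlinarith [mul_le_mul_of_nonneg_left this hK]
  have hinc : |levelSum H j (e j) t - levelSum H j (e j) τ|
      ≤ 2 * C₂ * (K * (1 + j)) * levelScale α r j := by
    have h3 := h₂ j t τ 1 Hlo (1 / 2) hτI (hsmall.trans hle1) one_pos le_rfl hlohi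
      (by norm_num) (by linarith) (.of_range hrange j τ 1)
    have h4 : (2 ^ j * |t - τ|) ^ (1 / 2 : ℝ) ≤ (2 : ℝ) ^ (-(j : ℝ)) := by
      calc (2 ^ j * |t - τ|) ^ (1 / 2 : ℝ) ≤ ((2 : ℝ) ^ (-(4 * j : ℝ))) ^ (1 / 2 : ℝ) := by
            gcongr
        _ ≤ _ := by
            rw [← Real.rpow_mul two_pos.le]
            refine Real.rpow_le_rpow_of_exponent_le one_le_two ?_
            have : (0 : ℝ) ≤ j := j.cast_nonneg
            linarith
    have h5 : levelScale Hlo 1 j ≤ 2 := by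
      have e1 : (2 : ℝ) ^ (-(Hlo * j)) ≤ 1 :=
        Real.rpow_le_one_of_one_le_of_nonpos one_le_two (by simp; positivity)
      have e2 : (2 : ℝ) ^ (-(j : ℝ)) ≤ 1 :=
        Real.rpow_le_one_of_one_le_of_nonpos one_le_two (by simp)
      rw [levelScale, one_pow, div_one]; linarith
    have h6 : (2 : ℝ) ^ (-(j : ℝ)) ≤ levelScale α r j := by
      have e1 : (2 : ℝ) ^ (-(j : ℝ)) ≤ (2 : ℝ) ^ (-(j : ℝ)) / r ^ 3 :=
        le_div_self (by positivity) (by positivity) (pow_le_one₀ hr.le hr1)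
      have e2 : 0 ≤ (2 : ℝ) ^ (-(α * j)) := by positivity
      rw [levelScale]; linarith
    have hK : 0 ≤ K * (1 + (j : ℝ)) := mul_nonneg he.nonneg (by positivity)
    have h0 := (levelScale_pos (α := Hlo) one_pos j).le
    have h7 : C₂ * (2 ^ j * |t - τ|) ^ (1 / 2 : ℝ) * levelScale Hlo 1 j
        ≤ C₂ * levelScale α r j * 2 := by
      have := h4.trans h6
      have := (levelScale_pos (α := α) hr j).le
      gcongr
    calc _ ≤ _ := abs_levelSum_sub_le he j t τ
      _ ≤ K * (1 + j) * (C₂ * levelScale α r j * 2) := by gcongr; exact h3.trans h7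
      _ = _ := by ring
  calc |levelSum H j (e j) t|
      = |levelSum H j (e j) τ + (levelSum H j (e j) t - levelSum H j (e j) τ)| := by
        congr 1; ring
    _ ≤ |levelSum H j (e j) τ| + |levelSum H j (e j) t - levelSum H j (e j) τ| := abs_add_le _ _
    _ ≤ _ := by linarith

/-- The increments of a level are `O(|t - t₀| ^ α)`. At distances below `2^(-j)` this is the
regularity of the coefficients, at distances between `2^(-j)` and `r` it follows from the size of
the level near `t₀`, and beyond `r` from the size of the level everywhere. -/
theorem exists_abs_levelSum_sub_le {Hlo Hhi : ℝ} (hlo : 0 < Hlo) (hhi : Hhi < 1) {H : ℕ → ℝ → ℝ}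
    (hrange : ∀ j : ℕ, ∀ x ∈ Icc (0 : ℝ) 1, H j x ∈ Icc Hlo Hhi) :
    ∃ C : ℝ, 0 < C ∧ ∀ (e : (j : ℕ) → Fin (2 ^ j) → ℝ) (K : ℝ), NoiseBound H e K →
      ∀ (j : ℕ) (t t₀ r α α' : ℝ), t ∈ Icc (0 : ℝ) 1 → t₀ ∈ Icc (0 : ℝ) 1 → 0 < r → r ≤ 1 →
      0 ≤ α → α ≤ 1 → α ≤ Hlo + 1 / 2 → α' ≤ Hhi →
      1 / 2 ^ (5 * j) ≤ r → HurstLowerBound H j t₀ (3 * r) α' →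
      |levelSum H j (e j) t - levelSum H j (e j) t₀| ≤ |t - t₀| ^ α * (C * (K * (1 + j)) *
        ((2 : ℝ) ^ (α * j) * levelScale α' r j + levelScale Hlo 1 j / r)) := by
  have hlohi : Hlo ≤ Hhi := by
    have := hrange 0 0 ⟨le_rfl, zero_le_one⟩
    exact this.1.trans this.2
  obtain ⟨C₁, hC₁, h₁⟩ := exists_abs_levelSum_le hlo hhi hrange
  obtain ⟨C₂, hC₂, h₂⟩ := exists_sum_abs_ghbmpCoeff_sub_le hlo hhi hrange
  refine ⟨2 * C₁ + C₂, by positivity,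
    fun e K he j t t₀ r α α' ht ht₀ hr hr1 hα0 hα1 hαa hα' hj hb => ?_⟩
  have hK : 0 ≤ K * (1 + (j : ℝ)) := mul_nonneg he.nonneg (by positivity)
  have hG := (levelScale_pos (α := α') hr j).le
  have hG₀ := (levelScale_pos (α := Hlo) one_pos j).le
  set G := levelScale α' r j
  set G₀ := levelScale Hlo 1 j
  set P := (2 : ℝ) ^ (α * j) with hP
  have hP0 : 0 ≤ P := by positivity
  set h := |t - t₀| with hh
  have hh0 : 0 ≤ h := abs_nonneg _
  have hhα : 0 ≤ h ^ α := by positivity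
  have hh1 : h ≤ 1 := by rw [hh, abs_le]; constructor <;> linarith [ht.1, ht.2, ht₀.1, ht₀.2]
  have hscale : (2 ^ j * h) ^ α = h ^ α * P := by
    rw [Real.mul_rpow (by positivity) hh0, ← Real.rpow_natCast, ← Real.rpow_mul two_pos.le, hP,
      mul_comm α]
    ring
  rcases le_or_gt (2 ^ j * h) 1 with hc | hc
  · have h3 := h₂ j t t₀ r α' α ht₀ hc hr hr1 hα' hα1 hαa (hb.of_near (by simp; linarith))
    rw [← hh, hscale] at h3
    calc _ ≤ _ := abs_levelSum_sub_le he j t t₀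
      _ ≤ K * (1 + j) * (C₂ * (h ^ α * P) * G) := by gcongr
      _ = h ^ α * (C₂ * (K * (1 + j)) * (P * G + 0)) := by ring
      _ ≤ _ := by
        gcongr
        · linarith
        · positivity
  · have hsub := abs_sub (levelSum H j (e j) t) (levelSum H j (e j) t₀)
    rcases le_or_gt h r with hr' | hr'
    · have e1 := h₁ e K he j t r α' ht hr hr1 hα' hj
        (hb.of_near (by rw [abs_sub_comm]; linarith))
      have e2 := h₁ e K he j t₀ r α' ht₀ hr hr1 hα' hj (hb.of_near (by simp; linarith))
      have h4 : 1 ≤ h ^ α * P := by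
        rw [← hscale]; exact Real.one_le_rpow hc.le hα0
      calc _ ≤ 1 * (2 * C₁ * (K * (1 + j)) * G) := by linarith
        _ ≤ (h ^ α * P) * (2 * C₁ * (K * (1 + j)) * G) := by gcongr
        _ = h ^ α * (2 * C₁ * (K * (1 + j)) * (P * G + 0)) := by ring
        _ ≤ _ := by
          gcongr
          · linarith
          · positivity
    · have hj1 : (1 : ℝ) / 2 ^ (5 * j) ≤ 1 := hj.trans hr1
      have e1 := h₁ e K he j t 1 Hlo ht one_pos le_rfl hlohi hj1 (.of_range hrange _ _ _)
      have e2 := h₁ e K he j t₀ 1 Hlo ht₀ one_pos le_rfl hlohi hj1 (.of_range hrange _ _ _)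
      have h4 : 1 ≤ h ^ α / r := by
        rw [one_le_div hr]
        have := Real.rpow_le_rpow_of_exponent_ge (hr.trans hr') hh1 hα1
        rw [Real.rpow_one] at this
        linarith
      calc _ ≤ 1 * (2 * C₁ * (K * (1 + j)) * G₀) := by linarith
        _ ≤ (h ^ α / r) * (2 * C₁ * (K * (1 + j)) * G₀) := by gcongr
        _ = h ^ α * (2 * C₁ * (K * (1 + j)) * (0 + G₀ / r)) := by ring
        _ ≤ _ := by
          gcongr
          · linarith
          · positivity

theorem summable_pow_mul_two_rpow (n : ℕ) {b : ℝ} (hb : 0 < b) :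
    Summable fun j : ℕ => (1 + (j : ℝ)) ^ n * (2 : ℝ) ^ (-(b * j)) := by
  have hq : (2 : ℝ) ^ (-b) < 1 := Real.rpow_lt_one_of_one_lt_of_neg one_lt_two (by linarith)
  have hq0 : 0 < (2 : ℝ) ^ (-b) := by positivity
  have h := summable_pow_mul_geometric_of_norm_lt_one n (r := (2 : ℝ) ^ (-b))
    (by rwa [Real.norm_eq_abs, abs_of_pos hq0])
  have h' := ((summable_nat_add_iff 1).2 h).mul_left ((2 : ℝ) ^ b)
  refine h'.congr fun j => ?_
  have : (2 : ℝ) ^ (-(b * j)) = ((2 : ℝ) ^ (-b)) ^ j := by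
    rw [← Real.rpow_natCast, ← Real.rpow_mul two_pos.le]; congr 1; ring
  have h1 : (2 : ℝ) ^ b * (2 : ℝ) ^ (-b) = 1 := by rw [← Real.rpow_add two_pos]; simp
  rw [this, pow_succ]
  push_cast
  linear_combination ((j : ℝ) + 1) ^ n * ((2 : ℝ) ^ (-b)) ^ j * h1

theorem summable_mul_levelScale {α r : ℝ} (hα : 0 < α) (n : ℕ) :
    Summable fun j : ℕ => (1 + (j : ℝ)) ^ n * levelScale α r j := by
  refine ((summable_pow_mul_two_rpow n hα).add
    ((summable_pow_mul_two_rpow n one_pos).div_const (r ^ 3))).congr fun j => ?_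
  rw [levelScale, one_mul]; ring

/-- The Lipschitz bounds of the parameters grow so slowly that a lower bound for `H_j(t₀)`, valid
for all large `j`, extends to distance `O(1 / (1 + j))` with an arbitrarily small loss. -/
theorem exists_eventually_hurstLowerBound {Hlo Hhi C : ℝ} {H : ℕ → ℝ → ℝ}
    (hrange : ∀ j : ℕ, ∀ x ∈ Icc (0 : ℝ) 1, H j x ∈ Icc Hlo Hhi) (hC : 0 < C)
    (hL : ∀ j : ℕ, ∀ x ∈ Icc (0 : ℝ) 1, ∀ y ∈ Icc (0 : ℝ) 1,
      |H j x - H j y| ≤ C * (1 + j) * |x - y|)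
    {t₀ α' : ℝ} (ht₀ : t₀ ∈ Icc (0 : ℝ) 1) (hα' : α' < hurstFunction H t₀) :
    ∃ ρ : ℝ, 0 < ρ ∧ ρ ≤ 1 ∧ ∀ᶠ j : ℕ in atTop,
      HurstLowerBound H j t₀ (3 * (ρ / (1 + j))) α' := by
  obtain ⟨β, hβ, hβ'⟩ := exists_between hα'
  have hev : ∀ᶠ j : ℕ in atTop, β < H j t₀ :=
    eventually_lt_of_lt_liminf hβ' (isBoundedUnder_of ⟨Hlo, fun j => (hrange j t₀ ht₀).1⟩)
  refine ⟨min 1 ((β - α') / (3 * C)), lt_min one_pos (div_pos (by linarith) (by positivity)),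
    min_le_left _ _, hev.mono fun j hj k hk => ?_⟩
  have h1 := hL j t₀ ht₀ _ (dyadic_mem_Icc k)
  have hj0 : (0 : ℝ) < 1 + j := by positivity
  have h2 : C * (1 + j) * |t₀ - (k : ℕ) / 2 ^ j| ≤ β - α' := by
    calc _ ≤ C * (1 + j) * (3 * (min 1 ((β - α') / (3 * C)) / (1 + j))) := by gcongr
      _ = 3 * C * min 1 ((β - α') / (3 * C)) := by field_simp
      _ ≤ 3 * C * ((β - α') / (3 * C)) := by gcongr; exact min_le_right _ _
      _ = β - α' := by field_simp
  linarith [(abs_le.1 (h1.trans h2)).2]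

theorem eventually_one_div_two_pow_le {ρ : ℝ} (hρ : 0 < ρ) :
    ∀ᶠ j : ℕ in atTop, (1 : ℝ) / 2 ^ (5 * j) ≤ ρ / (1 + j) := by
  have h := (summable_pow_mul_two_rpow 1 (b := 5) (by norm_num)).tendsto_atTop_zero
  filter_upwards [h.eventually_le_const hρ] with j hj
  have hj0 : (0 : ℝ) < 1 + j := by positivity
  rw [le_div_iff₀ hj0]
  refine le_trans (le_of_eq ?_) hj
  rw [Real.rpow_neg two_pos.le, pow_one, mul_comm, one_div]
  congr 2
  rw [← Real.rpow_natCast]; push_cast; rfl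

theorem hurstFunction_mem_Icc {Hlo Hhi : ℝ} {H : ℕ → ℝ → ℝ}
    (hrange : ∀ j : ℕ, ∀ x ∈ Icc (0 : ℝ) 1, H j x ∈ Icc Hlo Hhi) {t : ℝ}
    (ht : t ∈ Icc (0 : ℝ) 1) : hurstFunction H t ∈ Icc Hlo Hhi := by
  have hb : IsBoundedUnder (· ≥ ·) atTop fun j : ℕ => H j t :=
    isBoundedUnder_of ⟨Hlo, fun j => (hrange j t ht).1⟩
  have hb' : IsBoundedUnder (· ≤ ·) atTop fun j : ℕ => H j t :=
    isBoundedUnder_of ⟨Hhi, fun j => (hrange j t ht).2⟩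
  exact ⟨le_liminf_of_le hb'.isCoboundedUnder_ge
      (Eventually.of_forall fun j => (hrange j t ht).1),
    liminf_le_of_frequently_le (Frequently.of_forall fun j => (hrange j t ht).2) hb⟩

/-- Below the Hurst function, the increments of the levels at a point sum up to a Hölder bound. -/
theorem exists_summable_increment_bound {Hlo Hhi C : ℝ} (hlo : 0 < Hlo) (hhi : Hhi < 1)
    {H : ℕ → ℝ → ℝ} (hrange : ∀ j : ℕ, ∀ x ∈ Icc (0 : ℝ) 1, H j x ∈ Icc Hlo Hhi) (hC : 0 < C)
    (hL : ∀ j : ℕ, ∀ x ∈ Icc (0 : ℝ) 1, ∀ y ∈ Icc (0 : ℝ) 1,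
      |H j x - H j y| ≤ C * (1 + j) * |x - y|)
    {e : (j : ℕ) → Fin (2 ^ j) → ℝ} {K : ℝ} (he : NoiseBound H e K)
    {t₀ α : ℝ} (ht₀ : t₀ ∈ Icc (0 : ℝ) 1) (hα0 : 0 ≤ α) (hα : α < hurstFunction H t₀)
    (hαa : α ≤ Hlo + 1 / 2) :
    ∃ b : ℕ → ℝ, Summable b ∧ ∀ (j : ℕ), ∀ t ∈ Icc (0 : ℝ) 1,
      |levelSum H j (e j) t - levelSum H j (e j) t₀| ≤ |t - t₀| ^ α * b j := by
  have hlohi : Hlo ≤ Hhi := by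
    have := hrange 0 0 ⟨le_rfl, zero_le_one⟩
    exact this.1.trans this.2
  obtain ⟨α', hαα', hα'⟩ := exists_between hα
  have hHhi := (hurstFunction_mem_Icc hrange ht₀).2
  have hα'1 : α' ≤ Hhi := hα'.le.trans hHhi
  obtain ⟨ρ, hρ, hρ1, hev⟩ := exists_eventually_hurstLowerBound hrange hC hL ht₀ hα'
  obtain ⟨D, hD, hinc⟩ := exists_abs_levelSum_sub_le hlo hhi hrange
  -- `b₁` is the bound for large `j`; the finitely many other levels only have the bound `b₂`, where
  -- the trivial lower bound `Hlo` of the parameters is used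
  set b₁ : ℕ → ℝ := fun j => D * (K * (1 + j)) * ((2 : ℝ) ^ (α * j) *
    levelScale α' (ρ / (1 + j)) j + levelScale Hlo 1 j / (ρ / (1 + j)))
  set b₂ : ℕ → ℝ := fun j => D * (K * (1 + j)) * ((2 : ℝ) ^ (α * j) *
    levelScale Hlo 1 j + levelScale Hlo 1 j / 1)
  have hb₁ : Summable b₁ := by
    have s1 := summable_pow_mul_two_rpow 1 (sub_pos.2 hαα')
    have s2 := summable_pow_mul_two_rpow 4 (b := 1 - α) (by linarith)
    have s3 := summable_mul_levelScale (r := 1) hlo 2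
    refine ((s1.add ((s2.div_const (ρ ^ 3)).add (s3.div_const ρ))).mul_left (D * K)).congr
      fun j => ?_
    have hj0 : (1 + (j : ℝ)) ≠ 0 := by positivity
    have e1 : (2 : ℝ) ^ (-((α' - α) * j)) = (2 : ℝ) ^ (α * j) * (2 : ℝ) ^ (-(α' * j)) := by
      rw [← Real.rpow_add two_pos]; congr 1; ring
    have e2 : (2 : ℝ) ^ (-((1 - α) * j)) = (2 : ℝ) ^ (α * j) * (2 : ℝ) ^ (-(j : ℝ)) := by
      rw [← Real.rpow_add two_pos]; congr 1; ring
    simp only [b₁]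
    rw [e1, e2, show levelScale α' (ρ / (1 + j)) j = (2 : ℝ) ^ (-(α' * j))
      + (2 : ℝ) ^ (-(j : ℝ)) / (ρ / (1 + j)) ^ 3 from rfl]
    field_simp
    ring
  have hgood := hev.and (eventually_one_div_two_pow_le hρ)
  classical
  refine ⟨fun j => if HurstLowerBound H j t₀ (3 * (ρ / (1 + j))) α' ∧
      (1 : ℝ) / 2 ^ (5 * j) ≤ ρ / (1 + j) then b₁ j else b₂ j,
    (summable_congr_atTop (hgood.mono fun j hj => if_pos hj)).2 hb₁, fun j t ht => ?_⟩
  have hj0 : (1 : ℝ) ≤ 1 + j := by simp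
  beta_reduce
  split_ifs with h
  · exact hinc e K he j t t₀ (ρ / (1 + j)) α α' ht ht₀ (by positivity)
      ((div_le_one (by positivity)).2 (hρ1.trans hj0)) hα0 (by linarith) hαa hα'1 h.2 h.1
  · exact hinc e K he j t t₀ 1 α Hlo ht ht₀ one_pos le_rfl hα0 (by linarith) hαa hlohi
      ((div_le_one (by positivity)).2 (one_le_pow₀ one_le_two)) (.of_range hrange _ _ _)

theorem exists_summable_levelSum_bound {Hlo Hhi : ℝ} (hlo : 0 < Hlo) (hhi : Hhi < 1)
    {H : ℕ → ℝ → ℝ} (hrange : ∀ j : ℕ, ∀ x ∈ Icc (0 : ℝ) 1, H j x ∈ Icc Hlo Hhi)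
    {e : (j : ℕ) → Fin (2 ^ j) → ℝ} {K : ℝ} (he : NoiseBound H e K) :
    ∃ b : ℕ → ℝ, Summable b ∧ ∀ (j : ℕ), ∀ t ∈ Icc (0 : ℝ) 1, |levelSum H j (e j) t| ≤ b j := by
  have hlohi : Hlo ≤ Hhi := by
    have := hrange 0 0 ⟨le_rfl, zero_le_one⟩
    exact this.1.trans this.2
  obtain ⟨C, hC, h⟩ := exists_abs_levelSum_le hlo hhi hrange
  refine ⟨fun j => C * (K * (1 + j)) * levelScale Hlo 1 j,
    ((summable_mul_levelScale (r := 1) hlo 1).mul_left (C * K)).congr fun j => by ring,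
    fun j t ht => h e K he j t 1 Hlo ht one_pos le_rfl hlohi
      ((div_le_one (by positivity)).2 (one_le_pow₀ one_le_two)) (.of_range hrange _ _ _)⟩

theorem continuous_levelSum {Hlo Hhi : ℝ} (hlo : 0 < Hlo) {H : ℕ → ℝ → ℝ}
    (hrange : ∀ j : ℕ, ∀ x ∈ Icc (0 : ℝ) 1, H j x ∈ Icc Hlo Hhi) (j : ℕ)
    (e : Fin (2 ^ j) → ℝ) : Continuous (levelSum H j e) := by
  refine continuous_finsetSum _ fun k _ => Continuous.mul_const ?_ _
  have hHk := hrange j _ (dyadic_mem_Icc k)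
  have h : ghbmpCoeff H j k = fun t => _ :=
    funext fun t => ghbmpCoeff_eq k.2 (by linarith [hHk.1]) t
  rw [h]
  exact ((continuous_haarPrimitive (by linarith [hHk.1])).comp
    ((continuous_const.mul continuous_id).sub continuous_const)).const_mul _

/-! ### The pointwise Hölder exponent of the sum -/

theorem abs_sub_le_of_lipNorm_le {f : ℝ → ℝ} {L : NNReal} {C : ℝ}
    (hf : LipschitzOnWith L f (Icc (0 : ℝ) 1)) (hC : lipNorm f ≤ C) :
    ∀ x ∈ Icc (0 : ℝ) 1, ∀ y ∈ Icc (0 : ℝ) 1, |f x - f y| ≤ C * |x - y| := by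
  have key : ∀ x ∈ Icc (0 : ℝ) 1, ∀ y ∈ Icc (0 : ℝ) 1, x < y → |f y - f x| ≤ C * (y - x) := by
    intro x hx y hy hxy
    have hbdd : BddAbove {r : ℝ | ∃ x ∈ Icc (0 : ℝ) 1, ∃ y ∈ Icc (0 : ℝ) 1,
        x < y ∧ r = |f y - f x| / (y - x)} := by
      refine ⟨L, ?_⟩
      rintro _ ⟨u, hu, v, hv, huv, rfl⟩
      rw [div_le_iff₀ (sub_pos.2 huv)]
      have := hf.dist_le_mul v hv u hu
      rwa [Real.dist_eq, Real.dist_eq, abs_of_pos (sub_pos.2 huv)] at this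
    have h1 : |f y - f x| / (y - x) ≤ sSup {r : ℝ | ∃ x ∈ Icc (0 : ℝ) 1, ∃ y ∈ Icc (0 : ℝ) 1,
        x < y ∧ r = |f y - f x| / (y - x)} := le_csSup hbdd ⟨x, hx, y, hy, hxy, rfl⟩
    have h2 : 0 ≤ sSup {r : ℝ | ∃ x ∈ Icc (0 : ℝ) 1, r = |f x|} :=
      Real.sSup_nonneg (by rintro _ ⟨u, _, rfl⟩; exact abs_nonneg _)
    rw [lipNorm] at hC
    rw [← div_le_iff₀ (sub_pos.2 hxy)]
    linarith
  intro x hx y hy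
  rcases lt_trichotomy x y with h | h | h
  · rw [abs_sub_comm, abs_sub_comm x, abs_of_pos (sub_pos.2 h)]
    exact key x hx y hy h
  · simp [h]
  · rw [abs_of_pos (sub_pos.2 h)]
    exact key y hy x hx h

theorem neBot_nhdsWithin_increments {t : ℝ} (ht : t ∈ Ioo (0 : ℝ) 1) :
    (𝓝[{h : ℝ | h ≠ 0 ∧ t + h ∈ Icc (0 : ℝ) 1}] 0).NeBot := by
  have hmem : {h : ℝ | t + h ∈ Icc (0 : ℝ) 1} ∈ 𝓝 (0 : ℝ) := by
    have hc : ContinuousAt (fun h : ℝ => t + h) 0 := by fun_prop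
    exact hc.preimage_mem_nhds (by simpa using Icc_mem_nhds ht.1 ht.2)
  have : {h : ℝ | h ≠ 0 ∧ t + h ∈ Icc (0 : ℝ) 1} = {h | t + h ∈ Icc (0 : ℝ) 1} ∩ {0}ᶜ := by
    ext h; simp [and_comm]
  rw [this, nhdsWithin_inter_of_mem (nhdsWithin_le_nhds hmem)]
  infer_instance

theorem le_holderExponent {f : ℝ → ℝ} {t η : ℝ} (ht : t ∈ Ioo (0 : ℝ) 1) (hη : 0 < η)
    (hf : ∀ α, 0 ≤ α → α < η → ∃ B : ℝ, ∀ s ∈ Icc (0 : ℝ) 1, |f s - f t| ≤ |s - t| ^ α * B) :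
    (η : EReal) ≤ holderExponent f t := by
  by_contra hcon
  obtain ⟨c, hc1, hc2⟩ := EReal.lt_iff_exists_real_btwn.1 (not_le.1 hcon)
  rw [EReal.coe_lt_coe_iff] at hc2
  -- the exponents in the definition are nonnegative, so `c` is replaced by `max c 0`
  have hβ : max c 0 < η := max_lt hc2 hη
  obtain ⟨α, hα, hαη⟩ := exists_between hβ
  obtain ⟨B, hB⟩ := hf α ((le_max_right _ _).trans hα.le) hαη
  refine absurd hc1 (not_lt.2 ?_)
  refine le_trans (EReal.coe_le_coe_iff.2 (le_max_left c 0))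
    (le_sSup ⟨max c 0, ⟨le_max_right _ _, ?_⟩, rfl⟩)
  have := neBot_nhdsWithin_increments ht
  refine Tendsto.limsup_eq ?_
  rw [← EReal.coe_zero]
  refine (continuous_coe_real_ereal.tendsto 0).comp ?_
  have hlim : Tendsto (fun h : ℝ => |h| ^ (α - max c 0) * B)
      (𝓝[{h : ℝ | h ≠ 0 ∧ t + h ∈ Icc (0 : ℝ) 1}] 0) (𝓝 0) := by
    have hpos : 0 < α - max c 0 := by linarith
    have hcont : Continuous fun h : ℝ => |h| ^ (α - max c 0) * B :=
      ((continuous_abs.rpow_const fun _ => Or.inr hpos.le)).mul_const B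
    have := hcont.tendsto 0
    simp only [abs_zero, Real.zero_rpow hpos.ne', zero_mul] at this
    exact this.mono_left nhdsWithin_le_nhds
  refine squeeze_zero' (Eventually.of_forall fun h => by positivity) ?_ hlim
  filter_upwards [self_mem_nhdsWithin] with h hh
  have hpos : 0 < |h| := abs_pos.2 hh.1
  rw [div_le_iff₀ (by positivity), mul_right_comm, ← Real.rpow_add hpos, sub_add_cancel]
  simpa using hB (t + h) hh.2

/-! ### The Gaussian noise -/

theorem hasSubgaussianMGF_of_hasLaw_gaussianReal {Ω : Type*} [MeasurableSpace Ω]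
    {μ : Measure Ω} {X : Ω → ℝ} (hX : HasLaw X (gaussianReal 0 1) μ) : HasSubgaussianMGF X 1 μ := by
  rw [← HasSubgaussianMGF.id_map_iff hX.aemeasurable, hX.map_eq]
  refine ⟨fun t => integrable_exp_mul_gaussianReal t, fun t => ?_⟩
  rw [mgf_id_gaussianReal]
  simp

theorem iIndepFun_level_mul {Ω : Type*} [MeasurableSpace Ω] {μ : Measure Ω}
    {ε : (j : ℕ) → Fin (2 ^ j) → Ω → ℝ}
    (hindep : iIndepFun (fun p : (j : ℕ) × Fin (2 ^ j) => ε p.1 p.2) μ) (j : ℕ)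
    (c : Fin (2 ^ j) → ℝ) : iIndepFun (fun k ω => c k * ε j k ω) μ :=
  (hindep.precomp (g := fun k : Fin (2 ^ j) => (⟨j, k⟩ : (j : ℕ) × Fin (2 ^ j)))
    fun _ _ h => by simpa using h).comp (fun k x => c k * x) fun k => measurable_const_mul _

theorem hasSubgaussianMGF_levelSum {Ω : Type*} [MeasurableSpace Ω] {μ : Measure Ω}
    {ε : (j : ℕ) → Fin (2 ^ j) → Ω → ℝ}
    (hgauss : ∀ (j : ℕ) (k : Fin (2 ^ j)), HasLaw (ε j k) (gaussianReal 0 1) μ)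
    (hindep : iIndepFun (fun p : (j : ℕ) × Fin (2 ^ j) => ε p.1 p.2) μ)
    (H : ℕ → ℝ → ℝ) (j : ℕ) (t : ℝ) :
    HasSubgaussianMGF (fun ω => levelSum H j (fun k => ε j k ω) t)
      (∑ k : Fin (2 ^ j), ‖ghbmpCoeff H j k t‖₊ ^ 2) μ := by
  refine HasSubgaussianMGF.sum_of_iIndepFun (iIndepFun_level_mul hindep j _) fun k _ => ?_
  convert (hasSubgaussianMGF_of_hasLaw_gaussianReal (hgauss j k)).const_mul
    (ghbmpCoeff H j k t) using 1
  refine Eq.trans (NNReal.eq ?_) (mul_one (⟨ghbmpCoeff H j k t ^ 2, sq_nonneg _⟩ : NNReal)).symm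
  rw [NNReal.coe_pow, coe_nnnorm, Real.norm_eq_abs, sq_abs]
  rfl

section Noise

variable {Ω : Type*} [MeasurableSpace Ω] {μ : Measure Ω} [IsProbabilityMeasure μ]
  {ε : (j : ℕ) → Fin (2 ^ j) → Ω → ℝ}

theorem measure_mul_sqrt_lt_abs_le {X : Ω → ℝ} {c : NNReal} (hX : HasSubgaussianMGF X c μ)
    (hc : c ≠ 0) {l : ℝ} (hl : 0 ≤ l) :
    μ {ω | l * √c < |X ω|} ≤ ENNReal.ofReal (2 * Real.exp (-l ^ 2 / 2)) := by
  have hc' : (0 : ℝ) < c := by positivity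
  have hexp : -(l * √(c : ℝ)) ^ 2 / (2 * c) = -l ^ 2 / 2 := by
    rw [mul_pow, Real.sq_sqrt hc'.le]; field_simp
  have h1 := hX.measure_ge_le (ε := l * √c) (by positivity)
  have h2 := hX.neg.measure_ge_le (ε := l * √c) (by positivity)
  rw [hexp] at h1 h2
  have hsub : {ω | l * √c < |X ω|} ⊆ {ω | l * √c ≤ X ω} ∪ {ω | l * √c ≤ (-X) ω} := by
    intro ω hω
    rcases lt_abs.1 (show l * √c < |X ω| by simpa using hω) with h | h
    · exact Or.inl h.le
    · exact Or.inr h.le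
  rw [← ofReal_measureReal]
  refine ENNReal.ofReal_le_ofReal ?_
  calc _ ≤ _ := measureReal_mono hsub
    _ ≤ _ := measureReal_union_le _ _
    _ ≤ _ := by linarith

theorem measurable_levelSum (hmeas : ∀ (j : ℕ) (k : Fin (2 ^ j)), Measurable (ε j k))
    (H : ℕ → ℝ → ℝ) (j : ℕ) (t : ℝ) :
    Measurable fun ω => levelSum H j (fun k => ε j k ω) t :=
  Finset.measurable_fun_sum _ fun k _ => (hmeas j k).const_mul _

theorem measurable_ghbmpPartialSum (hmeas : ∀ (j : ℕ) (k : Fin (2 ^ j)), Measurable (ε j k))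
    (H : ℕ → ℝ → ℝ) (n : ℕ) (t : ℝ) : Measurable (ghbmpPartialSum H ε n t) :=
  Finset.measurable_fun_sum _ fun j _ => measurable_levelSum hmeas H j t

theorem abs_ghbmpCoeff_le_levelStd (H : ℕ → ℝ → ℝ) (j : ℕ) (k : Fin (2 ^ j)) (t : ℝ) :
    |ghbmpCoeff H j k t| ≤ levelStd H j t := by
  refine Real.abs_le_sqrt ?_
  exact Finset.single_le_sum (f := fun k : Fin (2 ^ j) => ghbmpCoeff H j k t ^ 2)
    (fun _ _ => sq_nonneg _) (Finset.mem_univ k)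

theorem abs_levelSum_le_levelStd_mul (H : ℕ → ℝ → ℝ) (j : ℕ) (e : Fin (2 ^ j) → ℝ) (t : ℝ) :
    |levelSum H j e t| ≤ (∑ k, |e k|) * levelStd H j t := by
  rw [levelSum, Finset.sum_mul]
  refine (Finset.abs_sum_le_sum_abs _ _).trans (Finset.sum_le_sum fun k _ => ?_)
  rw [abs_mul, mul_comm]
  exact mul_le_mul_of_nonneg_left (abs_ghbmpCoeff_le_levelStd H j k t) (abs_nonneg _)

theorem measure_levelStd_lt_abs_levelSum_le
    (hgauss : ∀ (j : ℕ) (k : Fin (2 ^ j)), HasLaw (ε j k) (gaussianReal 0 1) μ)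
    (hindep : iIndepFun (fun p : (j : ℕ) × Fin (2 ^ j) => ε p.1 p.2) μ)
    (H : ℕ → ℝ → ℝ) (j : ℕ) (t : ℝ) {l : ℝ} (hl : 0 ≤ l) :
    μ {ω | l * levelStd H j t < |levelSum H j (fun k => ε j k ω) t|}
      ≤ ENNReal.ofReal (2 * Real.exp (-l ^ 2 / 2)) := by
  have hc : ((∑ k : Fin (2 ^ j), ‖ghbmpCoeff H j k t‖₊ ^ 2 : NNReal) : ℝ)
      = ∑ k : Fin (2 ^ j), ghbmpCoeff H j k t ^ 2 := by
    push_cast; simp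
  by_cases h0 : (∑ k : Fin (2 ^ j), ‖ghbmpCoeff H j k t‖₊ ^ 2 : NNReal) = 0
  · -- a level of zero variance vanishes identically
    have hstd : levelStd H j t = 0 := by
      rw [levelStd, ← hc, h0]; simp
    have : {ω | l * levelStd H j t < |levelSum H j (fun k => ε j k ω) t|} = ∅ := by
      refine eq_empty_of_forall_notMem fun ω hω => ?_
      have h1 := abs_levelSum_le_levelStd_mul H j (fun k => ε j k ω) t
      rw [hstd, mul_zero] at h1
      rw [mem_ofPred_eq, hstd, mul_zero] at hω
      exact absurd h1 (not_le.2 hω)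
    rw [this, measure_empty]
    exact zero_le
  · have := measure_mul_sqrt_lt_abs_le (hasSubgaussianMGF_levelSum hgauss hindep H j t) h0 hl
    rwa [hc] at this

theorem summable_two_pow_mul_exp :
    Summable fun j : ℕ => (2 : ℝ) ^ (5 * j) * Real.exp (-(1 + (j : ℝ)) ^ 2 / 2) := by
  have he : (2 : ℝ) ^ 5 * Real.exp (-5) < 1 := by
    have h1 : (2 : ℝ) < Real.exp 1 := by linarith [Real.exp_one_gt_d9]
    have h2 : (2 : ℝ) ^ 5 < Real.exp 1 ^ 5 := pow_lt_pow_left₀ h1 (by norm_num) (by norm_num)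
    rw [← Real.exp_nat_mul] at h2
    norm_num at h2 ⊢
    rw [Real.exp_neg, ← div_eq_mul_inv, div_lt_one (Real.exp_pos _)]
    exact h2
  refine Summable.of_nonneg_of_le (fun j => by positivity) (fun j => ?_)
    ((summable_geometric_of_lt_one (by positivity) he).mul_left (Real.exp (15 / 2)))
  rw [mul_pow, ← pow_mul, ← Real.exp_nat_mul, mul_left_comm, ← Real.exp_add]
  gcongr
  -- `(1 + j)² / 2 ≥ 5 (1 + j) - 25 / 2`, and `exp 5` exceeds `2 ^ 5`
  nlinarith [sq_nonneg ((j : ℝ) - 4)]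

/-- A Gaussian variable exceeds `1 + j` standard deviations with probability at most
`2 exp (-(1 + j)² / 2)`, which beats the number `2^j + 2^(5j) + 1` of variables of level `j`. -/
theorem ae_exists_noiseBound
    (hgauss : ∀ (j : ℕ) (k : Fin (2 ^ j)), HasLaw (ε j k) (gaussianReal 0 1) μ)
    (hindep : iIndepFun (fun p : (j : ℕ) × Fin (2 ^ j) => ε p.1 p.2) μ) (H : ℕ → ℝ → ℝ) :
    ∀ᵐ ω ∂μ, ∃ K : ℝ, NoiseBound H (fun j k => ε j k ω) K := by
  set bad : ℕ → Set Ω := fun j => (⋃ k : Fin (2 ^ j), {ω | (1 + (j : ℝ)) < |ε j k ω|}) ∪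
    ⋃ n ∈ Finset.range (2 ^ (5 * j) + 1), {ω | (1 + (j : ℝ)) * levelStd H j ((n : ℝ) / 2 ^ (5 * j))
      < |levelSum H j (fun k => ε j k ω) ((n : ℝ) / 2 ^ (5 * j))|} with hbad
  have hle : ∀ j, μ (bad j) ≤
      ENNReal.ofReal (6 * ((2 : ℝ) ^ (5 * j) * Real.exp (-(1 + (j : ℝ)) ^ 2 / 2))) := by
    intro j
    set T := ENNReal.ofReal (2 * Real.exp (-(1 + (j : ℝ)) ^ 2 / 2)) with hT
    have h1 : μ (⋃ k : Fin (2 ^ j), {ω | (1 + (j : ℝ)) < |ε j k ω|}) ≤ (2 ^ j : ℕ) * T := by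
      refine (measure_iUnion_fintype_le _ _).trans ?_
      refine (Finset.sum_le_card_nsmul _ _ T fun k _ => ?_).trans_eq (by simp)
      have := measure_mul_sqrt_lt_abs_le (hasSubgaussianMGF_of_hasLaw_gaussianReal (hgauss j k))
        one_ne_zero (l := 1 + j) (by positivity)
      simpa only [NNReal.coe_one, Real.sqrt_one, mul_one] using this
    have h2 : μ (⋃ n ∈ Finset.range (2 ^ (5 * j) + 1),
        {ω | (1 + (j : ℝ)) * levelStd H j ((n : ℝ) / 2 ^ (5 * j))
          < |levelSum H j (fun k => ε j k ω) ((n : ℝ) / 2 ^ (5 * j))|})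
        ≤ (2 ^ (5 * j) + 1 : ℕ) * T := by
      refine (measure_biUnion_finset_le _ _).trans ?_
      refine (Finset.sum_le_card_nsmul _ _ T fun n _ => ?_).trans_eq (by simp)
      exact measure_levelStd_lt_abs_levelSum_le hgauss hindep H j _ (by positivity)
    have h3 : 2 ^ j + (2 ^ (5 * j) + 1) ≤ 3 * 2 ^ (5 * j) := by
      have e1 : 2 ^ j ≤ 2 ^ (5 * j) := Nat.pow_le_pow_right two_pos (by omega)
      have e2 : 1 ≤ 2 ^ (5 * j) := Nat.one_le_two_pow
      omega
    calc μ (bad j) ≤ _ := measure_union_le _ _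
      _ ≤ (2 ^ j : ℕ) * T + (2 ^ (5 * j) + 1 : ℕ) * T := add_le_add h1 h2
      _ = ((2 ^ j + (2 ^ (5 * j) + 1) : ℕ) : ENNReal) * T := by
        rw [Nat.cast_add (2 ^ j), add_mul]
      _ ≤ ((3 * 2 ^ (5 * j) : ℕ) : ENNReal) * T := by gcongr
      _ = _ := by
        rw [hT, ← ENNReal.ofReal_natCast, ← ENNReal.ofReal_mul (by positivity)]
        congr 1; push_cast; ring
  have hsum : ∑' j, μ (bad j) ≠ ⊤ :=
    ne_top_of_le_ne_top (summable_two_pow_mul_exp.mul_left 6).tsum_ofReal_ne_top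
      (ENNReal.tsum_le_tsum hle)
  filter_upwards [ae_eventually_notMem hsum] with ω hω
  obtain ⟨J, hJ⟩ := eventually_atTop.1 hω
  have hS : ∀ j, 0 ≤ ∑ k, |ε j k ω| := fun j => Finset.sum_nonneg fun k _ => abs_nonneg _
  have hK1 : (1 : ℝ) ≤ 1 + ∑ j ∈ Finset.range J, ∑ k, |ε j k ω| := by
    have := Finset.sum_nonneg (s := Finset.range J) fun j _ => hS j
    linarith
  -- below `J` the constant absorbs the whole noise of the level, by the triangle inequality
  refine ⟨1 + ∑ j ∈ Finset.range J, ∑ k, |ε j k ω|, by linarith, fun j k => ?_, fun j n hn => ?_⟩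
  all_goals
    set K := 1 + ∑ j ∈ Finset.range J, ∑ k, |ε j k ω| with hK
    have hj1 : (1 : ℝ) ≤ 1 + j := by simp
    have hlow : j < J → ∑ k, |ε j k ω| ≤ K * (1 + j) := fun hj => by
      have h1 := Finset.single_le_sum (f := fun j => ∑ k, |ε j k ω|) (fun j _ => hS j)
        (Finset.mem_range.2 hj)
      beta_reduce at h1
      nlinarith
  · rcases lt_or_ge j J with hj | hj
    · exact (Finset.single_le_sum (f := fun k => |ε j k ω|) (fun _ _ => abs_nonneg _)
        (Finset.mem_univ k)).trans (hlow hj)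
    · have h1 : ¬ (1 + (j : ℝ)) < |ε j k ω| := fun h =>
        hJ j hj (Or.inl (mem_iUnion.2 ⟨k, h⟩))
      nlinarith
  · have h0 : 0 ≤ levelStd H j ((n : ℝ) / 2 ^ (5 * j)) := Real.sqrt_nonneg _
    rcases lt_or_ge j J with hj | hj
    · exact (abs_levelSum_le_levelStd_mul H j _ _).trans (mul_le_mul_of_nonneg_right (hlow hj) h0)
    · have h1 : ¬ (1 + (j : ℝ)) * levelStd H j ((n : ℝ) / 2 ^ (5 * j))
          < |levelSum H j (fun k => ε j k ω) ((n : ℝ) / 2 ^ (5 * j))| := fun h =>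
        hJ j hj (Or.inr (mem_biUnion (Finset.mem_coe.2 (Finset.mem_range.2 (by omega))) h))
      refine (not_lt.1 h1).trans (mul_le_mul_of_nonneg_right ?_ h0)
      nlinarith

theorem eLpNorm_levelSum
    (hgauss : ∀ (j : ℕ) (k : Fin (2 ^ j)), HasLaw (ε j k) (gaussianReal 0 1) μ)
    (hindep : iIndepFun (fun p : (j : ℕ) × Fin (2 ^ j) => ε p.1 p.2) μ)
    (H : ℕ → ℝ → ℝ) (j : ℕ) (t : ℝ) :
    eLpNorm (fun ω => levelSum H j (fun k => ε j k ω) t) 2 μ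
      = ENNReal.ofReal (levelStd H j t) := by
  have hL2 : MemLp (fun ω => levelSum H j (fun k => ε j k ω) t) 2 μ := by
    simpa using (hasSubgaussianMGF_levelSum hgauss hindep H j t).memLp 2
  have hε : ∀ k, MemLp (ε j k) 2 μ := fun k => by
    simpa using (hasSubgaussianMGF_of_hasLaw_gaussianReal (hgauss j k)).memLp 2
  have hmean : ∀ k, ∫ ω, ε j k ω ∂μ = 0 := fun k => by
    rw [(hgauss j k).integral_eq, integral_id_gaussianReal]
  have hmean' : ∫ ω, levelSum H j (fun k => ε j k ω) t ∂μ = 0 := by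
    simp only [levelSum]
    rw [integral_finsetSum _ fun k _ => ((hε k).integrable (by norm_num)).const_mul _]
    simp [integral_const_mul, hmean]
  have hvar : ∫ ω, levelSum H j (fun k => ε j k ω) t ^ 2 ∂μ
      = ∑ k : Fin (2 ^ j), ghbmpCoeff H j k t ^ 2 := by
    rw [← variance_of_integral_eq_zero hL2.aemeasurable hmean']
    have h1 : (fun ω => levelSum H j (fun k => ε j k ω) t)
        = ∑ k : Fin (2 ^ j), fun ω => ghbmpCoeff H j k t * ε j k ω := by
      ext ω; simp [levelSum]
    rw [h1, IndepFun.variance_sum (fun k _ => (hε k).const_mul _)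
      fun k _ l _ hkl => (iIndepFun_level_mul hindep j _).indepFun hkl]
    refine Finset.sum_congr rfl fun k _ => ?_
    rw [variance_const_mul, (hgauss j k).variance_eq, variance_id_gaussianReal]
    simp
  rw [hL2.eLpNorm_eq_integral_rpow_norm (by norm_num) (by norm_num), levelStd, ← hvar,
    Real.sqrt_eq_rpow]
  simp

end Noise

/-! ### The process -/

/-- The sum of the Haar series for the realisation `e` of the noise. -/
noncomputable def haarSeries (H : ℕ → ℝ → ℝ) (e : (j : ℕ) → Fin (2 ^ j) → ℝ) (t : ℝ) : ℝ :=
  ∑' j, levelSum H j (e j) t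

theorem summable_levelSum {Hlo Hhi : ℝ} (hlo : 0 < Hlo) (hhi : Hhi < 1)
    {H : ℕ → ℝ → ℝ} (hrange : ∀ j : ℕ, ∀ x ∈ Icc (0 : ℝ) 1, H j x ∈ Icc Hlo Hhi)
    {e : (j : ℕ) → Fin (2 ^ j) → ℝ} {K : ℝ} (he : NoiseBound H e K) {t : ℝ}
    (ht : t ∈ Icc (0 : ℝ) 1) : Summable fun j => levelSum H j (e j) t := by
  obtain ⟨b, hb, h⟩ := exists_summable_levelSum_bound hlo hhi hrange he
  exact Summable.of_norm_bounded hb fun j => h j t ht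

theorem continuousOn_haarSeries {Hlo Hhi : ℝ} (hlo : 0 < Hlo) (hhi : Hhi < 1)
    {H : ℕ → ℝ → ℝ} (hrange : ∀ j : ℕ, ∀ x ∈ Icc (0 : ℝ) 1, H j x ∈ Icc Hlo Hhi)
    {e : (j : ℕ) → Fin (2 ^ j) → ℝ} {K : ℝ} (he : NoiseBound H e K) :
    ContinuousOn (haarSeries H e) (Icc (0 : ℝ) 1) := by
  obtain ⟨b, hb, h⟩ := exists_summable_levelSum_bound hlo hhi hrange he
  exact continuousOn_tsum (fun j => (continuous_levelSum hlo hrange j (e j)).continuousOn) hb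
    fun j t ht => h j t ht

theorem hurstFunction_le_holderExponent {Hlo Hhi C : ℝ} (hlo : 0 < Hlo) (hhi : Hhi < 1)
    {H : ℕ → ℝ → ℝ} (hrange : ∀ j : ℕ, ∀ x ∈ Icc (0 : ℝ) 1, H j x ∈ Icc Hlo Hhi) (hC : 0 < C)
    (hL : ∀ j : ℕ, ∀ x ∈ Icc (0 : ℝ) 1, ∀ y ∈ Icc (0 : ℝ) 1,
      |H j x - H j y| ≤ C * (1 + j) * |x - y|)
    {e : (j : ℕ) → Fin (2 ^ j) → ℝ} {K : ℝ} (he : NoiseBound H e K) {f : ℝ → ℝ}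
    (hf : EqOn f (haarSeries H e) (Icc (0 : ℝ) 1)) {t : ℝ} (ht : t ∈ Ioo (0 : ℝ) 1)
    (hHt : hurstFunction H t < Hlo + 1 / 2) :
    (hurstFunction H t : EReal) ≤ holderExponent f t := by
  have htI := Ioo_subset_Icc_self ht
  refine le_holderExponent ht (hlo.trans_le (hurstFunction_mem_Icc hrange htI).1)
    fun α hα0 hα => ?_
  obtain ⟨b, hb, h⟩ := exists_summable_increment_bound hlo hhi hrange hC hL he htI hα0 hα
    (by linarith)
  refine ⟨∑' j, b j, fun s hs => ?_⟩
  rw [hf hs, hf htI, haarSeries, haarSeries,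
    ← (summable_levelSum hlo hhi hrange he hs).tsum_sub (summable_levelSum hlo hhi hrange he htI)]
  exact tsum_of_norm_bounded (f := fun j => levelSum H j (e j) s - levelSum H j (e j) t)
    (hb.hasSum.mul_left _) fun j => h j s hs

theorem tendsto_ghbmpPartialSum {Hlo Hhi : ℝ} (hlo : 0 < Hlo) (hhi : Hhi < 1)
    {Ω : Type*} {ε : (j : ℕ) → Fin (2 ^ j) → Ω → ℝ}
    {H : ℕ → ℝ → ℝ} (hrange : ∀ j : ℕ, ∀ x ∈ Icc (0 : ℝ) 1, H j x ∈ Icc Hlo Hhi)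
    {ω : Ω} {K : ℝ}
    (he : NoiseBound H (fun j k => ε j k ω) K) {t : ℝ} (ht : t ∈ Icc (0 : ℝ) 1) :
    Tendsto (fun n => ghbmpPartialSum H ε n t ω) atTop
      (𝓝 (haarSeries H (fun j k => ε j k ω) t)) :=
  (summable_levelSum hlo hhi hrange he ht).hasSum.tendsto_sum_nat

section RandomSeries

variable {Ω : Type*} [MeasurableSpace Ω] {μ : Measure Ω} [IsProbabilityMeasure μ]
  {ε : (j : ℕ) → Fin (2 ^ j) → Ω → ℝ}

/-- The almost sure limit of the series is also its `L²` limit, the norms of the levels being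
summable. -/
theorem tendsto_eLpNorm_sub_ghbmpPartialSum {Hlo Hhi : ℝ} (hlo : 0 < Hlo) (hhi : Hhi < 1)
    {H : ℕ → ℝ → ℝ} (hrange : ∀ j : ℕ, ∀ x ∈ Icc (0 : ℝ) 1, H j x ∈ Icc Hlo Hhi)
    (hmeas : ∀ (j : ℕ) (k : Fin (2 ^ j)), Measurable (ε j k))
    (hgauss : ∀ (j : ℕ) (k : Fin (2 ^ j)), HasLaw (ε j k) (gaussianReal 0 1) μ)
    (hindep : iIndepFun (fun p : (j : ℕ) × Fin (2 ^ j) => ε p.1 p.2) μ)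
    {t : ℝ} (ht : t ∈ Icc (0 : ℝ) 1) {Y : Ω → ℝ}
    (hY : ∀ᵐ ω ∂μ, Tendsto (fun n => ghbmpPartialSum H ε n t ω) atTop (𝓝 (Y ω))) :
    Tendsto (fun n : ℕ => eLpNorm (fun ω => Y ω - ghbmpPartialSum H ε n t ω) 2 μ) atTop
      (𝓝 0) := by
  have hlohi : Hlo ≤ Hhi := by
    have := hrange 0 0 ⟨le_rfl, zero_le_one⟩
    exact this.1.trans this.2
  obtain ⟨C, hC, hstd⟩ := exists_levelStd_le hlo hhi hrange
  have hsum : Summable fun j => levelStd H j t :=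
    Summable.of_nonneg_of_le (fun j => Real.sqrt_nonneg _)
      (fun j => hstd j t 1 Hlo ht one_pos le_rfl hlohi (.of_range hrange j t 1))
      (((summable_mul_levelScale (r := 1) hlo 0).mul_left C).congr fun j => by simp)
  refine tendsto_of_tendsto_of_tendsto_of_le_of_le tendsto_const_nhds
    (ENNReal.tendsto_sum_nat_add (fun j => ENNReal.ofReal (levelStd H j t))
      hsum.tsum_ofReal_ne_top) (fun n => zero_le) fun n => ?_
  refine Lp.eLpNorm_le_of_ae_tendsto (u := atTop)
    (f := fun m ω => ghbmpPartialSum H ε (m + n) t ω - ghbmpPartialSum H ε n t ω)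
    (Eventually.of_forall fun m => ?_)
    (fun m => ((measurable_ghbmpPartialSum hmeas H _ t).sub
      (measurable_ghbmpPartialSum hmeas H _ t)).aestronglyMeasurable)
    (hY.mono fun ω hω => (hω.comp (tendsto_add_atTop_nat n)).sub_const _)
  have hdiff : (fun ω => ghbmpPartialSum H ε (m + n) t ω - ghbmpPartialSum H ε n t ω)
      = ∑ i ∈ Finset.range m, fun ω => levelSum H (i + n) (fun k => ε (i + n) k ω) t := by
    ext ω
    rw [Finset.sum_apply, add_comm m n, ghbmpPartialSum, ghbmpPartialSum, Finset.sum_range_add,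
      add_sub_cancel_left]
    exact Finset.sum_congr rfl fun i _ => by rw [add_comm n i]; rfl
  rw [hdiff]
  refine (eLpNorm_sum_le (fun i _ => (measurable_levelSum hmeas H _ t).aestronglyMeasurable)
    (by norm_num)).trans ?_
  simp only [eLpNorm_levelSum hgauss hindep]
  exact ENNReal.sum_le_tsum _

theorem exists_isGHBMP {Hlo Hhi : ℝ} (hlo : 0 < Hlo) (hhi : Hhi < 1)
    {H : ℕ → ℝ → ℝ} (hrange : ∀ j : ℕ, ∀ x ∈ Icc (0 : ℝ) 1, H j x ∈ Icc Hlo Hhi)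
    (hmeas : ∀ (j : ℕ) (k : Fin (2 ^ j)), Measurable (ε j k))
    (hgauss : ∀ (j : ℕ) (k : Fin (2 ^ j)), HasLaw (ε j k) (gaussianReal 0 1) μ)
    (hindep : iIndepFun (fun p : (j : ℕ) × Fin (2 ^ j) => ε p.1 p.2) μ) :
    ∃ X : ℝ → Ω → ℝ, IsGHBMP μ H ε X := by
  obtain ⟨A, hA, hAm, hAK⟩ := (ae_exists_noiseBound hgauss hindep H).exists_measurable_mem
  -- setting the process to zero outside `A` makes it measurable, without completeness of `μ`
  refine ⟨fun t => A.indicator fun ω => haarSeries H (fun j k => ε j k ω) t, ?_, ?_, ?_⟩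
  · intro t ht
    refine measurable_of_tendsto_metrizable
      (fun n => (measurable_ghbmpPartialSum hmeas H n t).indicator hAm)
      (tendsto_pi_nhds.2 fun ω => ?_)
    by_cases hω : ω ∈ A
    · obtain ⟨K, hK⟩ := hAK ω hω
      simpa [hω] using tendsto_ghbmpPartialSum hlo hhi hrange hK ht
    · simp [hω]
  · intro t ht
    refine tendsto_eLpNorm_sub_ghbmpPartialSum hlo hhi hrange hmeas hgauss hindep ht ?_
    filter_upwards [hA] with ω hω
    obtain ⟨K, hK⟩ := hAK ω hω
    simpa [hω] using tendsto_ghbmpPartialSum hlo hhi hrange hK ht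
  · filter_upwards [hA] with ω hω
    obtain ⟨K, hK⟩ := hAK ω hω
    simpa [hω] using continuousOn_haarSeries hlo hhi hrange hK

/-- A version of the process agrees almost surely with the sum of the series at each rational time,
hence, both being continuous, at all times simultaneously. -/
theorem IsGHBMP.ae_eqOn_haarSeries {Hlo Hhi : ℝ} (hlo : 0 < Hlo) (hhi : Hhi < 1)
    {H : ℕ → ℝ → ℝ} (hrange : ∀ j : ℕ, ∀ x ∈ Icc (0 : ℝ) 1, H j x ∈ Icc Hlo Hhi)
    (hmeas : ∀ (j : ℕ) (k : Fin (2 ^ j)), Measurable (ε j k))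
    (hgauss : ∀ (j : ℕ) (k : Fin (2 ^ j)), HasLaw (ε j k) (gaussianReal 0 1) μ)
    (hindep : iIndepFun (fun p : (j : ℕ) × Fin (2 ^ j) => ε p.1 p.2) μ)
    {X : ℝ → Ω → ℝ} (hX : IsGHBMP μ H ε X) :
    ∀ᵐ ω ∂μ, EqOn (fun t => X t ω) (haarSeries H fun j k => ε j k ω) (Icc (0 : ℝ) 1) := by
  have hK := ae_exists_noiseBound hgauss hindep H
  have hfix : ∀ t ∈ Icc (0 : ℝ) 1, ∀ᵐ ω ∂μ, X t ω = haarSeries H (fun j k => ε j k ω) t := by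
    intro t ht
    have hm : ∀ n, AEStronglyMeasurable (ghbmpPartialSum H ε n t) μ := fun n =>
      (measurable_ghbmpPartialSum hmeas H n t).aestronglyMeasurable
    refine tendstoInMeasure_ae_unique (u := atTop) (f := fun n => ghbmpPartialSum H ε n t)
      (tendstoInMeasure_of_tendsto_eLpNorm (p := 2) (by norm_num) hm
        (hX.measurable t ht).aestronglyMeasurable ?_)
      (tendstoInMeasure_of_tendsto_ae hm ?_)
    · refine (hX.tendsto_L2 t ht).congr fun n => ?_
      exact eLpNorm_sub_comm _ _ _ _
    · filter_upwards [hK] with ω hω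
      obtain ⟨K, hω⟩ := hω
      exact tendsto_ghbmpPartialSum hlo hhi hrange hω ht
  have hrat : ∀ᵐ ω ∂μ, ∀ q : ℚ, (q : ℝ) ∈ Icc (0 : ℝ) 1 →
      X q ω = haarSeries H (fun j k => ε j k ω) q := by
    rw [ae_all_iff]
    intro q
    by_cases hq : (q : ℝ) ∈ Icc (0 : ℝ) 1
    · exact (hfix q hq).mono fun ω h _ => h
    · exact Eventually.of_forall fun ω h => absurd h hq
  filter_upwards [hK, hrat, hX.continuous_paths] with ω ⟨K, hω⟩ hq hc
  refine EqOn.of_subset_closure (s := Ioo (0 : ℝ) 1 ∩ range ((↑) : ℚ → ℝ)) ?_ hc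
    (continuousOn_haarSeries hlo hhi hrange hω)
    (inter_subset_left.trans Ioo_subset_Icc_self) ?_
  · rintro _ ⟨h, q, rfl⟩
    exact hq q (Ioo_subset_Icc_self h)
  · rw [← closure_Ioo (zero_ne_one (α := ℝ))]
    exact closure_minimal (Rat.denseRange_cast.open_subset_closure_inter isOpen_Ioo)
      isClosed_closure

end RandomSeries

theorem mainTheorem2 {Ω : Type*} [MeasurableSpace Ω] (μ : Measure Ω) [IsProbabilityMeasure μ]
    (Hlo Hhi : ℝ) (hlo : 0 < Hlo) (hhi : Hhi < 1)
    (H : ℕ → ℝ → ℝ)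
    (hrange : ∀ j : ℕ, ∀ x ∈ Icc (0 : ℝ) 1, H j x ∈ Icc Hlo Hhi)
    (hlip : ∀ j : ℕ, ∃ L : NNReal, LipschitzOnWith L (H j) (Icc (0 : ℝ) 1))
    (hgrowth : ∃ C : ℝ, 0 < C ∧ ∀ j : ℕ, lipNorm (H j) ≤ C * (1 + (j : ℝ)))
    (hH : ∀ t ∈ Ioo (0 : ℝ) 1, hurstFunction H t < Hlo + 1 / 2)
    (ε : (j : ℕ) → Fin (2 ^ j) → Ω → ℝ)
    (hmeas : ∀ (j : ℕ) (k : Fin (2 ^ j)), Measurable (ε j k))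
    (hgauss : ∀ (j : ℕ) (k : Fin (2 ^ j)), HasLaw (ε j k) (gaussianReal 0 1) μ)
    (hindep : iIndepFun (fun p : (j : ℕ) × Fin (2 ^ j) => ε p.1 p.2) μ) :
    (∃ X : ℝ → Ω → ℝ, IsGHBMP μ H ε X) ∧
    ∀ X : ℝ → Ω → ℝ, IsGHBMP μ H ε X →
      ∃ Ω₁ : Set Ω, MeasurableSet Ω₁ ∧ μ Ω₁ = 1 ∧
        ∀ ω ∈ Ω₁, ∀ t ∈ Ioo (0 : ℝ) 1,
          (hurstFunction H t : EReal) ≤ holderExponent (fun s => X s ω) t := by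
  obtain ⟨C, hC, hCj⟩ := hgrowth
  have hL : ∀ j : ℕ, ∀ x ∈ Icc (0 : ℝ) 1, ∀ y ∈ Icc (0 : ℝ) 1,
      |H j x - H j y| ≤ C * (1 + j) * |x - y| := fun j =>
    (hlip j).elim fun L hLj => abs_sub_le_of_lipNorm_le hLj (hCj j)
  refine ⟨exists_isGHBMP hlo hhi hrange hmeas hgauss hindep, fun X hX => ?_⟩
  obtain ⟨Ω₁, h1, hm, hΩ⟩ := ((hX.ae_eqOn_haarSeries hlo hhi hrange hmeas hgauss hindep).and
    (ae_exists_noiseBound hgauss hindep H)).exists_measurable_mem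
  refine ⟨Ω₁, hm, (mem_ae_iff_prob_eq_one hm).1 h1, fun ω hω t ht => ?_⟩
  obtain ⟨heq, K, hK⟩ := hΩ ω hω
  exact hurstFunction_le_holderExponent hlo hhi hrange hC hL hK heq ht (hH t ht)
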